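/- Let $\mathcal Y$ be a finite set, $\mathbb S$ the simplex of probability measures on $\mathcal Y$, and $(P_\tau)_{\tau\in\Theta}\subset\mathbb S$ an identifiable model ($\tau\mapsto P_\tau$ injective) all of whose members have only positive entries. Let $W$ be a real random variable whose moment generating function is finite near $0$, with $E W=1$ and $\operatorname{Var}W=1$, let $M(t)=\log E e^{tW}$ and $\varphi^W(x)=\sup_t\,(tx-M(t))$, and assume that $\varphi^W$ is a Cressie–Read power divergence function: for some $\gamma\in\mathbb R$, $\varphi^W(x)=\varphi_\gamma(x)$ for all $x>0$, where $\varphi_\gamma(x)=\frac{x^\gamma-\gamma x+\gamma-1}{\gamma(\gamma-1)}$ for $\gamma\neq0,1$, $\varphi_0(x)=-\log x+x-1$, $\varphi_1(x)=x\log x-x+1$. For a signed measure $Q$ on $\mathcal Y$ and $P\in\mathbb S$ with positive entries put $$\phi^W(Q,P)=\sum_k p_k\,\varphi^W(q_k/p_k),\qquad \Phi(Q,P)=\inf_{m\ne0}\phi^W(mQ,P),\qquad \widetilde\Phi(P,Q)=\Phi(Q,P),$$ and write $\theta$ for $P_\theta$ in the arguments of $\Phi$, $\widetilde\Phi$ and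 $S$. Fix $\theta\neq\theta'$ in $\Theta$ and consider the test of $H_0:\theta_T=\theta$ against $H_1:\theta_T=\theta'$. Let $X_1,X_2,\dots$ and $Z_1,Z_2,\dots$ be $\mathcal Y$-valued random variables whose empirical measures converge almost surely to $P_\theta$ and to $P_{\theta'}$ respectively. Let $W_1,W_2,\dots,W_1',W_2',\dots$ be i.i.d. copies of $W$, independent of $((X_i)_i,(Z_i)_i)$. Let $\mathfrak P_{n,X}^{W}=\sum_{i\le n}\frac{W_i}{\sum_{j\le n}W_j}\delta_{X_i}$, and $\mathfrak P_{n,X}^W=\infty$ if $\sum_{j\le n}W_j=0$; define $\mathfrak P_{n,Z}^{W'}$ in the same way. For an extended-real-valued function $S$ of a signed measure (or of the symbol $\infty$) let $$L_n^S(t)=\mathbb P\big(S(\mathfrak P_{n,X}^W)>t\,\big|\,X_1,\dots,X_n\big).$$ The test that rejects for large values of $S(\mathfrak P_{n,X}^W)$ has Bahadur slope $c\in[-\infty,\infty]$ if $\frac1n\log L_n^S\big(S(\mathfrak P_{n,Z}^{W'})\big)\to-c$ almost surely. Call $S$ a continuous functional if its restriction to $\mathbb S$ is continuous with values in $[-\infty,\infty]$.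 Let $$I_S=\inf\{\Phi(Q,\theta):Q\in\mathbb S,\ S(Q)>S(\theta')\},\qquad \inf\emptyset=+\infty .$$ Then the statistic $T_{n,X}=T(\mathfrak P_{n,X}^W)$ with $T(Q)=\widetilde\Phi(\theta,Q)$, $T(\infty)=+\infty$, is most efficient in the sense of Bahadur among tests based on continuous functionals of the bootstrapped measure: 1. $T$ is a continuous functional, $P_{\theta'}$ is not a local maximum point of $T$ on $\mathbb S$, and the test based on $T$ has Bahadur slope $\Phi(\theta',\theta)$. 2. For every continuous functional $S$: (a) almost surely $\liminf_n\frac1n\log L_n^S\big(S(\mathfrak P_{n,Z}^{W'})\big)\ge -I_S$. (b) If $S=-\infty$ outside $\mathbb S$ (no rejection when the bootstrapped measure is not a probability measure) and $I_S=\inf\{\Phi(Q,\theta):Q\in\mathbb S,\ S(Q)\ge S(\theta')\}$, then the test based on $S$ has Bahadur slope $I_S$. (c) If $P_{\theta'}$ is not a local maximum point of $S$ on $\mathbb S$, i.e. $P_{\theta'}$ lies in the closure of $\{Q\in\mathbb S:S(Q)>S(\theta')\}$, then $I_S\le\Phi(\theta',\theta)$ and almost surely $$\liminf_n\tfrac1n\log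 L_n^S\big(S(\mathfrak P_{n,Z}^{W'})\big)\ \ge\ -\Phi(\theta',\theta);$$ consequently, if the test based on $S$ has a Bahadur slope, this slope is at most $\Phi(\theta',\theta)$, the slope of $T$. -/

import Mathlib

open MeasureTheory ProbabilityTheory Filter Topology

noncomputable section

namespace GenBootstrap

/-- `M(t) = log E exp(tW)` for a weight `W` of law `ν`, with value `⊤` where the
expectation is infinite. -/
def cumulant (ν : Measure ℝ) (t : ℝ) : EReal :=
  ENNReal.log (∫⁻ w, ENNReal.ofReal (Real.exp (t * w)) ∂ν)

/-- `φ^W(x) = sup_t (t x - M(t))`, the Fenchel-Legendre transform of the cumulant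
generating function. -/
def chernoff (ν : Measure ℝ) (x : ℝ) : EReal :=
  ⨆ t : ℝ, ((t * x : ℝ) : EReal) - cumulant ν t

/-- Assumptions on the law of a weight: exponential moments near `0`, mean `1`, variance `1`. -/
structure IsWeightLaw (ν : Measure ℝ) : Prop where
  exp_moment : ∃ ε : ℝ, 0 < ε ∧ ∀ t : ℝ, |t| < ε → Integrable (fun w => Real.exp (t * w)) ν
  mean : ∫ w, w ∂ν = 1
  variance : Var[fun w => w; ν] = 1

/-- The Cressie-Read power divergence function `φ_γ` (used at `x > 0` only). -/
def powerFun (γ x : ℝ) : ℝ :=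
  if γ = 0 then -Real.log x + x - 1
  else if γ = 1 then x * Real.log x - x + 1
  else (x ^ γ - γ * x + γ - 1) / (γ * (γ - 1))

/-- The Legendre transform `φ^W` is the power divergence function `φ_γ`. On `x ≤ 0` the
function `φ^W` is given by the law of the weight. -/
def IsPowerWeight (ν : Measure ℝ) (γ : ℝ) : Prop :=
  ∀ x : ℝ, 0 < x → chernoff ν x = (powerFun γ x : EReal)

variable {Y : Type*} [Fintype Y]

/-- `φ^W(Q, P) = ∑ p_k φ^W(q_k / p_k)`, for a signed measure `Q` and a probability `P` with
positive entries. -/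
def divergence (ν : Measure ℝ) (Q P : Y → ℝ) : EReal :=
  ∑ k, (P k : EReal) * chernoff ν (Q k / P k)

/-- `Φ(Q, P) = inf_{m ≠ 0} φ^W(mQ, P)`. -/
def scaledDiv (ν : Measure ℝ) (Q P : Y → ℝ) : EReal :=
  ⨅ m : {m : ℝ // m ≠ 0}, divergence ν (m.1 • Q) P

/-- The conjugate divergence `Φ̃(P, Q) = Φ(Q, P)`. -/
def conjDiv (ν : Measure ℝ) (P Q : Y → ℝ) : EReal := scaledDiv ν Q P

open Classical in
/-- The mass at `k` of the empirical measure of `x 0, …, x (n-1)`. -/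
def empirical (n : ℕ) (x : ℕ → Y) (k : Y) : ℝ :=
  (((Finset.range n).filter fun i => x i = k).card : ℝ) / n

open Classical in
/-- The normalized weighted empirical measure `∑ i < n, (w i / ∑ j < n, w j) δ_{x i}`. The value
`none` is the symbol `∞`, used when the weights add up to `0`. -/
def bootMeasure (n : ℕ) (x : ℕ → Y) (w : ℕ → ℝ) : Option (Y → ℝ) :=
  if ∑ j ∈ Finset.range n, w j = 0 then none
  else some fun k => ∑ i ∈ (Finset.range n).filter (fun i => x i = k),
    w i / ∑ j ∈ Finset.range n, w j

/-- The divergence statistic `T(R) = Φ̃(P, R)`, with `T(∞) = +∞`. -/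
def divStat (ν : Measure ℝ) (P : Y → ℝ) : Option (Y → ℝ) → EReal
  | none => ⊤
  | some Q => conjDiv ν P Q

variable {Ω : Type*} [MeasurableSpace Ω]

/-- `L_n(t) = ℙ(S(𝔓_{n,X}^W) > t | X_1, …, X_n)`, at the outcome `ω`. As the observations are
discrete this is the elementary conditional probability given their values at `ω`. -/
def tailProb (μ : Measure Ω) (X : ℕ → Ω → Y) (W : ℕ → Ω → ℝ) (S : Option (Y → ℝ) → EReal)
    (n : ℕ) (t : EReal) (ω : Ω) : ENNReal :=
  μ[{ω' | t < S (bootMeasure n (fun i => X i ω') (fun i => W i ω'))} |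
    {ω' | ∀ i < n, X i ω' = X i ω}]

/-- `(1/n) log L_n(S(𝔓_{n,Z}^{W'}))`, at the outcome `ω`. -/
def logTail (μ : Measure Ω) (X Z : ℕ → Ω → Y) (W W' : ℕ → Ω → ℝ)
    (S : Option (Y → ℝ) → EReal) (n : ℕ) (ω : Ω) : EReal :=
  ENNReal.log (tailProb μ X W S n (S (bootMeasure n (fun i => Z i ω) (fun i => W' i ω))) ω)
    / (n : EReal)

/-- The test based on `S` has Bahadur slope `c`: almost surely
`(1/n) log L_n(S(𝔓_{n,Z}^{W'})) → -c`. -/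
def HasBahadurSlope (μ : Measure Ω) (X Z : ℕ → Ω → Y) (W W' : ℕ → Ω → ℝ)
    (S : Option (Y → ℝ) → EReal) (c : EReal) : Prop :=
  ∀ᵐ ω ∂μ, Tendsto (fun n => logTail μ X Z W W' S n ω) atTop (𝓝 (-c))

/-- `S` restricts to a continuous functional on the simplex of probability measures. -/
def IsContinuousFunctional (S : Option (Y → ℝ) → EReal) : Prop :=
  ContinuousOn (fun Q => S (some Q)) (stdSimplex ℝ Y)

/-- The probability measures at which `S` is strictly larger than at `P'`. -/
def exceedSet (S : Option (Y → ℝ) → EReal) (P' : Y → ℝ) : Set (Y → ℝ) :=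
  {Q ∈ stdSimplex ℝ Y | S (some P') < S (some Q)}

/-- The probability measures at which `S` is at least as large as at `P'`. -/
def weakExceedSet (S : Option (Y → ℝ) → EReal) (P' : Y → ℝ) : Set (Y → ℝ) :=
  {Q ∈ stdSimplex ℝ Y | S (some P') ≤ S (some Q)}

end GenBootstrap

end

/-! Given the observations, the bootstrapped measure depends only on the means of the weights over
the blocks of indices carrying the same letter. Block `k` contains about `n p_k` independent
weights, where `p = P_θ`, so by Cramér's theorem block means near `y` cost `exp(-n ∑ p_k φ^W(y_k))`.
Normalization forgets the total mass, so being near `Q` costs the infimum over multiples `mQ`, which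
is `Φ(Q, θ)`. Under the alternative the bootstrapped measure converges almost surely to `P_θ'`, so
the random threshold tends to `S(θ')`. The decay rate of the tail is then governed by `Φ(·, θ)` on
the set where `S` exceeds `S(θ')`.

Lower bound: `cramer_lower` tilts each block to its target mean. It needs positive targets, and
`exists_pos_near` supplies them by mixing slightly with `P_θ`. This gives `-I_S`. When `P_θ'` is a
limit of points of exceedance, continuity of `Φ(·, θ)` gives `I_S ≤ Φ(θ', θ)`, so no slope can be
larger.

Upper bound: with `N_k` the block sizes, each `N_k φ^W(mean_k)` has a tail of order `e^{-u}`,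
whatever the block size. Their sum therefore satisfies a Chernoff bound with any exponent `l < 1`
and a constant independent of `n` (`measure_le_sum_rate_le`), and no covering argument is needed. A
small sum forces a small divergence statistic (`eventually_divStat_le`), so `T` attains the bound.
For a general `S` supported on the simplex, compactness reduces exceedance of `S` to exceedance of
`T` (`exists_level`).

The power form of `φ^W` provides finiteness and a strictly increasing derivative on `(0, ∞)`, with
zero at `1`. Convexity then gives monotonicity on both sides of `1` and growth at `+∞`. The value
`φ^W(0)`, possibly infinite, is the critical level: multiples `m ≤ 0` and the event that the weights
sum to `0` cost at least `φ^W(0)`, while `Φ ≤ φ^W(0)` on the simplex. -/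

noncomputable section

namespace GenBootstrap

section

/-! ### The rate function -/

/-- The Fenchel-Legendre transform of the cumulant generating function, as an extended
nonnegative real. -/
def rate (ν : Measure ℝ) (x : ℝ) : ENNReal := (chernoff ν x).toENNReal

variable {ν : Measure ℝ}

lemma cumulant_eq_top {t : ℝ} (ht : t ∉ integrableExpSet id ν) : cumulant ν t = ⊤ := by
  rw [cumulant, ENNReal.log_eq_top_iff]
  by_contra h
  apply ht
  have hm : AEStronglyMeasurable (fun w : ℝ => Real.exp (t * w)) ν := by fun_prop
  refine ⟨hm, ?_⟩
  rw [hasFiniteIntegral_iff_ofReal (Eventually.of_forall fun w => (Real.exp_pos _).le)]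
  exact lt_top_iff_ne_top.2 h

lemma cumulant_eq_cgf [IsProbabilityMeasure ν] {t : ℝ} (ht : t ∈ integrableExpSet id ν) :
    cumulant ν t = (cgf id ν t : ℝ) := by
  have hi : Integrable (fun w : ℝ => Real.exp (t * w)) ν := ht
  rw [cumulant, ← ofReal_integral_eq_lintegral_ofReal hi
    (Eventually.of_forall fun w => (Real.exp_pos _).le), ENNReal.log_ofReal_of_pos]
  · rfl
  · exact mgf_pos (X := id) ht

lemma zero_mem_integrableExpSet [IsProbabilityMeasure ν] : (0 : ℝ) ∈ integrableExpSet id ν := by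
  simp [integrableExpSet]

lemma chernoff_nonneg [IsProbabilityMeasure ν] (x : ℝ) : 0 ≤ chernoff ν x := by
  refine le_trans ?_ (le_iSup _ (0 : ℝ))
  rw [cumulant_eq_cgf zero_mem_integrableExpSet]
  simp

lemma coe_rate [IsProbabilityMeasure ν] (x : ℝ) : (rate ν x : EReal) = chernoff ν x :=
  EReal.coe_toENNReal (chernoff_nonneg x)

/-- Slopes with infinite exponential moment contribute `-∞`, and truncating the others at `0`
changes nothing because the slope `0` already contributes `0`. -/
lemma rate_eq_iSup [IsProbabilityMeasure ν] (x : ℝ) :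
    rate ν x = ⨆ t : integrableExpSet id ν, ENNReal.ofReal (t.1 * x - cgf id ν t.1) := by
  apply le_antisymm
  · rw [← EReal.coe_ennreal_le_coe_ennreal_iff, coe_rate]
    refine iSup_le fun t => ?_
    by_cases ht : t ∈ integrableExpSet id ν
    · rw [cumulant_eq_cgf ht, ← EReal.coe_sub]
      refine le_trans ?_ (EReal.coe_ennreal_le_coe_ennreal_iff.2
        (le_iSup (fun t : integrableExpSet id ν => ENNReal.ofReal (t.1 * x - cgf id ν t.1)) ⟨t, ht⟩))
      rw [EReal.coe_ennreal_ofReal]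
      exact_mod_cast le_max_left _ _
    · rw [cumulant_eq_top ht, EReal.sub_top]
      exact bot_le
  · refine iSup_le fun t => ?_
    rw [rate, ← EReal.real_coe_toENNReal]
    apply EReal.toENNReal_le_toENNReal
    refine le_trans ?_ (le_iSup _ t.1)
    rw [cumulant_eq_cgf t.2, ← EReal.coe_sub]

lemma ofReal_le_rate [IsProbabilityMeasure ν] {t : ℝ} (ht : t ∈ integrableExpSet id ν) (x : ℝ) :
    ENNReal.ofReal (t * x - cgf id ν t) ≤ rate ν x := by
  rw [rate_eq_iSup]
  exact le_iSup (fun t : integrableExpSet id ν => ENNReal.ofReal (t.1 * x - cgf id ν t.1)) ⟨t, ht⟩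

lemma exists_lt_of_lt_rate [IsProbabilityMeasure ν] {x u : ℝ} (hu : 0 ≤ u)
    (h : ENNReal.ofReal u < rate ν x) :
    ∃ t ∈ integrableExpSet id ν, u < t * x - cgf id ν t := by
  rw [rate_eq_iSup, lt_iSup_iff] at h
  obtain ⟨t, ht⟩ := h
  exact ⟨t.1, t.2, (ENNReal.ofReal_lt_ofReal_iff_of_nonneg hu).1 ht⟩

lemma ofReal_finset_sum_le {ι : Type*} (s : Finset ι) (f : ι → ℝ) :
    ENNReal.ofReal (∑ i ∈ s, f i) ≤ ∑ i ∈ s, ENNReal.ofReal (f i) :=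
  Finset.le_sum_of_subadditive _ (by simp) (fun _ _ => ENNReal.ofReal_add_le) _ _

/-- Jensen's inequality for the rate function. -/
lemma rate_sum_le [IsProbabilityMeasure ν] {ι : Type*} [Fintype ι] {p : ι → ℝ}
    (hp : p ∈ stdSimplex ℝ ι) (x : ι → ℝ) :
    rate ν (∑ k, p k * x k) ≤ ∑ k, ENNReal.ofReal (p k) * rate ν (x k) := by
  rw [rate_eq_iSup]
  refine iSup_le fun t => ?_
  have h : t.1 * (∑ k, p k * x k) - cgf id ν t.1 = ∑ k, p k * (t.1 * x k - cgf id ν t.1) := by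
    simp_rw [mul_sub, Finset.sum_sub_distrib, ← Finset.sum_mul, hp.2, Finset.mul_sum]
    congr 1
    · exact Finset.sum_congr rfl fun _ _ => by ring
    · ring
  rw [h]
  refine (ofReal_finset_sum_le _ _).trans (Finset.sum_le_sum fun k _ => ?_)
  rw [ENNReal.ofReal_mul (hp.1 k)]
  gcongr
  exact ofReal_le_rate t.2 _

lemma rate_convex [IsProbabilityMeasure ν] {a b : ℝ} (ha : 0 ≤ a) (hb : 0 ≤ b) (hab : a + b = 1)
    (x y : ℝ) :
    rate ν (a * x + b * y) ≤ ENNReal.ofReal a * rate ν x + ENNReal.ofReal b * rate ν y := by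
  have hp : (![a, b] : Fin 2 → ℝ) ∈ stdSimplex ℝ (Fin 2) := by
    refine ⟨fun i => ?_, by simpa using hab⟩
    fin_cases i <;> simpa
  simpa using rate_sum_le (ν := ν) hp ![x, y]

lemma lowerSemicontinuous_rate [IsProbabilityMeasure ν] : LowerSemicontinuous (rate ν) := by
  have : rate ν = fun x => ⨆ t : integrableExpSet id ν,
      ENNReal.ofReal (t.1 * x - cgf id ν t.1) := funext rate_eq_iSup
  rw [this]
  refine lowerSemicontinuous_iSup fun t => Continuous.lowerSemicontinuous ?_
  exact ENNReal.continuous_ofReal.comp (by fun_prop)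

/-! ### Power functions -/

/-- The derivative of the power divergence function. -/
def powerDeriv (γ x : ℝ) : ℝ := if γ = 1 then Real.log x else (x ^ (γ - 1) - 1) / (γ - 1)

lemma hasDerivAt_powerFun (γ : ℝ) {x : ℝ} (hx : 0 < x) :
    HasDerivAt (powerFun γ) (powerDeriv γ x) x := by
  unfold powerDeriv
  by_cases h0 : γ = 0
  · have : powerFun γ = fun x => -Real.log x + x - 1 := by
      funext y; simp [powerFun, h0]
    rw [this, h0]
    refine HasDerivAt.congr_deriv
      (((Real.hasDerivAt_log hx.ne').neg.add (hasDerivAt_id x)).sub_const 1) ?_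
    rw [if_neg (by norm_num), zero_sub, Real.rpow_neg_one]
    ring
  · by_cases h1 : γ = 1
    · have : powerFun γ = fun x => x * Real.log x - x + 1 := by
        funext y; simp [powerFun, h1]
      rw [this, if_pos h1]
      refine HasDerivAt.congr_deriv ((((hasDerivAt_id x).mul (Real.hasDerivAt_log hx.ne')).sub
        (hasDerivAt_id x)).add_const 1) ?_
      simp [hx.ne']
    · have : powerFun γ = fun x => (x ^ γ - γ * x + γ - 1) / (γ * (γ - 1)) := by
        funext y; simp [powerFun, h0, h1]
      rw [this, if_neg h1]
      have h2 : γ - 1 ≠ 0 := sub_ne_zero.2 h1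
      refine HasDerivAt.congr_deriv (((((Real.hasDerivAt_rpow_const (p := γ)
        (Or.inl hx.ne')).sub ((hasDerivAt_id x).const_mul γ)).add_const γ).sub_const 1).div_const
        (γ * (γ - 1))) ?_
      field_simp

lemma powerDeriv_lt (γ : ℝ) {x y : ℝ} (hx : 0 < x) (hxy : x < y) :
    powerDeriv γ x < powerDeriv γ y := by
  unfold powerDeriv
  split_ifs with h
  · exact Real.log_lt_log hx hxy
  · rcases lt_or_gt_of_ne h with h | h
    · have := Real.rpow_lt_rpow_of_neg hx hxy (sub_neg.2 h)
      rw [div_lt_div_right_of_neg (sub_neg.2 h)]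
      linarith
    · have := Real.rpow_lt_rpow hx.le hxy (sub_pos.2 h)
      have := sub_pos.2 h
      gcongr

lemma powerFun_one (γ : ℝ) : powerFun γ 1 = 0 := by
  simp [powerFun]

lemma powerDeriv_one (γ : ℝ) : powerDeriv γ 1 = 0 := by
  simp [powerDeriv]

end

section

variable {ν : Measure ℝ}

/-! ### The rate function of a power weight -/

lemma rate_of_pos {γ : ℝ} (hγ : IsPowerWeight ν γ) {x : ℝ} (hx : 0 < x) :
    rate ν x = ENNReal.ofReal (powerFun γ x) := by
  rw [rate, hγ x hx, EReal.real_coe_toENNReal]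

lemma powerFun_nonneg [IsProbabilityMeasure ν] {γ : ℝ} (hγ : IsPowerWeight ν γ) {x : ℝ}
    (hx : 0 < x) : 0 ≤ powerFun γ x := by
  have := chernoff_nonneg (ν := ν) x
  rw [hγ x hx] at this
  exact_mod_cast this

/-- Nonnegativity is inherited from the Legendre transform. A zero is then a minimum, hence a
critical point, and the strictly increasing derivative vanishes only at `1`. -/
lemma powerFun_pos [IsProbabilityMeasure ν] {γ : ℝ} (hγ : IsPowerWeight ν γ) {x : ℝ}
    (hx : 0 < x) (hx1 : x ≠ 1) : 0 < powerFun γ x := by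
  refine lt_of_le_of_ne (powerFun_nonneg hγ hx) fun h => hx1 ?_
  have hmin : IsLocalMin (powerFun γ) x := by
    filter_upwards [Ioi_mem_nhds hx] with y hy
    rw [← h]
    exact powerFun_nonneg hγ hy
  have hd := hmin.hasDerivAt_eq_zero (hasDerivAt_powerFun γ hx)
  rcases lt_trichotomy x 1 with h1 | h1 | h1
  · have := powerDeriv_lt γ hx h1
    rw [powerDeriv_one] at this
    linarith
  · exact h1
  · have := powerDeriv_lt γ one_pos h1
    rw [powerDeriv_one] at this
    linarith

lemma rate_one {γ : ℝ} (hγ : IsPowerWeight ν γ) : rate ν 1 = 0 := by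
  rw [rate_of_pos hγ one_pos, powerFun_one, ENNReal.ofReal_zero]

/-- Only `0` needs an argument, since the power form says nothing there: zeros at both `0` and `1`
would by convexity force a zero at `1/2`. -/
lemma rate_pos [IsProbabilityMeasure ν] {γ : ℝ} (hγ : IsPowerWeight ν γ) {x : ℝ}
    (hx : 0 ≤ x) (hx1 : x ≠ 1) : 0 < rate ν x := by
  rcases hx.eq_or_lt with rfl | hx
  · by_contra h
    have h0 : rate ν 0 = 0 := by simpa using h
    have h2 := rate_convex (ν := ν) (a := 1 / 2) (b := 1 / 2) (by norm_num) (by norm_num)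
      (by norm_num) 0 1
    rw [h0, rate_one hγ, mul_zero, mul_zero, add_zero, nonpos_iff_eq_zero, zero_add,
      mul_one, rate_of_pos hγ one_half_pos, ENNReal.ofReal_eq_zero] at h2
    exact absurd (powerFun_pos hγ one_half_pos (by norm_num)) (not_lt.2 h2)
  · rw [rate_of_pos hγ hx, ENNReal.ofReal_pos]
    exact powerFun_pos hγ hx hx1

lemma rate_mul_le [IsProbabilityMeasure ν] {r : ℝ} (hr : 0 ≤ r) (hr1 : r ≤ 1) (x : ℝ) :
    rate ν (r * x) ≤ rate ν x + ENNReal.ofReal (1 - r) * rate ν 0 := by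
  have := rate_convex (ν := ν) hr (sub_nonneg.2 hr1) (by ring) x 0
  rw [mul_zero, add_zero] at this
  refine this.trans (add_le_add ?_ le_rfl)
  exact mul_le_of_le_one_left' (ENNReal.ofReal_le_one.2 hr1)

/-- Convexity against the zero at `1`: the rate contracts along segments towards `1`. This is the
source of the monotonicity and growth facts that follow. -/
lemma rate_toward_one_le [IsProbabilityMeasure ν] {γ : ℝ} (hγ : IsPowerWeight ν γ) {r : ℝ}
    (hr : 0 ≤ r) (hr1 : r ≤ 1) (x : ℝ) :
    rate ν (r * x + (1 - r)) ≤ ENNReal.ofReal r * rate ν x := by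
  have := rate_convex (ν := ν) hr (sub_nonneg.2 hr1) (by ring) x 1
  rwa [mul_one, rate_one hγ, mul_zero, add_zero] at this

lemma rate_zero_le [IsProbabilityMeasure ν] {γ : ℝ} (hγ : IsPowerWeight ν γ) {x : ℝ}
    (hx : x ≤ 0) : rate ν 0 ≤ rate ν x := by
  have h1 : 0 < 1 - x := by linarith
  have hr1 : 1 / (1 - x) ≤ 1 := by rw [div_le_one h1]; linarith
  have := rate_toward_one_le hγ (by positivity) hr1 x
  have h : 1 / (1 - x) * x + (1 - 1 / (1 - x)) = 0 := by field_simp; ring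
  rw [h] at this
  exact this.trans (mul_le_of_le_one_left' (ENNReal.ofReal_le_one.2 hr1))

lemma rate_le_zero [IsProbabilityMeasure ν] {γ : ℝ} (hγ : IsPowerWeight ν γ) {x : ℝ}
    (hx : 0 ≤ x) (hx1 : x ≤ 1) : rate ν x ≤ rate ν 0 := by
  have := rate_toward_one_le hγ (r := 1 - x) (by linarith) (by linarith) 0
  rw [mul_zero, zero_add, sub_sub_cancel] at this
  exact this.trans (mul_le_of_le_one_left' (ENNReal.ofReal_le_one.2 (by linarith)))

lemma rate_lt_zero [IsProbabilityMeasure ν] {γ : ℝ} (hγ : IsPowerWeight ν γ) {x : ℝ}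
    (hx : 0 < x) (hx1 : x ≤ 1) : rate ν x < rate ν 0 := by
  by_cases h0 : rate ν 0 = ⊤
  · rw [h0, rate_of_pos hγ hx]
    exact ENNReal.ofReal_lt_top
  have := rate_toward_one_le hγ (r := 1 - x) (by linarith) (by linarith) 0
  rw [mul_zero, zero_add, sub_sub_cancel] at this
  refine this.trans_lt ?_
  conv_rhs => rw [← one_mul (rate ν 0)]
  exact ENNReal.mul_lt_mul_left (rate_pos hγ le_rfl zero_ne_one).ne' h0
    (by rw [ENNReal.ofReal_lt_one]; linarith)

/-- The point `2` divides the segment from `1` to `x` at fraction `1 / (x - 1)`, so the rate grows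
at least linearly. -/
lemma sub_one_mul_rate_two_le [IsProbabilityMeasure ν] {γ : ℝ} (hγ : IsPowerWeight ν γ) {x : ℝ}
    (hx : 2 ≤ x) : ENNReal.ofReal (x - 1) * rate ν 2 ≤ rate ν x := by
  have h1 : 0 < x - 1 := by linarith
  have hr1 : 1 / (x - 1) ≤ 1 := by rw [div_le_one h1]; linarith
  have := rate_toward_one_le hγ (by positivity) hr1 x
  have h : 1 / (x - 1) * x + (1 - 1 / (x - 1)) = 2 := by field_simp; ring
  rw [h] at this
  calc _ ≤ ENNReal.ofReal (x - 1) * (ENNReal.ofReal (1 / (x - 1)) * rate ν x) := by gcongr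
    _ = rate ν x := by
      rw [← mul_assoc, ← ENNReal.ofReal_mul h1.le, mul_one_div_cancel h1.ne', ENNReal.ofReal_one,
        one_mul]

/-- The rate function is coercive at `+∞`. -/
lemma exists_le_rate [IsProbabilityMeasure ν] {γ : ℝ} (hγ : IsPowerWeight ν γ) (b : ℝ) :
    ∃ M : ℝ, 0 < M ∧ ∀ x, M ≤ x → ENNReal.ofReal b ≤ rate ν x := by
  have hc := powerFun_pos hγ (x := 2) (by norm_num) (by norm_num)
  refine ⟨max 2 (b / powerFun γ 2 + 1), by positivity, fun x hx => ?_⟩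
  have hx2 : 2 ≤ x := (le_max_left _ _).trans hx
  refine le_trans ?_ (sub_one_mul_rate_two_le hγ hx2)
  rw [rate_of_pos hγ two_pos, ← ENNReal.ofReal_mul (by linarith)]
  apply ENNReal.ofReal_le_ofReal
  rw [← div_le_iff₀ hc]
  linarith [(le_max_right _ _).trans hx]

lemma continuousAt_rate [IsProbabilityMeasure ν] {γ : ℝ} (hγ : IsPowerWeight ν γ) {x : ℝ}
    (hx : 0 < x) : ContinuousAt (rate ν) x := by
  have : rate ν =ᶠ[𝓝 x] fun y => ENNReal.ofReal (powerFun γ y) := by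
    filter_upwards [Ioi_mem_nhds hx] with y hy using rate_of_pos hγ hy
  rw [continuousAt_congr this]
  exact ENNReal.continuous_ofReal.continuousAt.comp (hasDerivAt_powerFun γ hx).continuousAt

/-- The delicate point is `0`, where the value may be infinite. Lower semicontinuity controls one
side, and the other follows because `φ^W(0)` dominates the rate on `[0, 1]`. -/
lemma continuous_rate_max [IsProbabilityMeasure ν] {γ : ℝ} (hγ : IsPowerWeight ν γ) :
    Continuous fun x : ℝ => rate ν (max x 0) := by
  have hlsc : LowerSemicontinuous fun x : ℝ => rate ν (max x 0) :=
    lowerSemicontinuous_rate.comp (by fun_prop)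
  rw [continuous_iff_continuousAt]
  intro x
  rcases lt_or_ge 0 x with hx | hx
  · exact ContinuousAt.comp (g := rate ν) (by rw [max_eq_left hx.le]; exact continuousAt_rate hγ hx)
      (by fun_prop)
  · refine tendsto_order.2 ⟨fun a ha => hlsc x a ha, fun a ha => ?_⟩
    change rate ν (max x 0) < a at ha
    rw [max_eq_right hx] at ha
    filter_upwards [Iio_mem_nhds (show x < 1 by linarith)] with y hy
    exact (rate_le_zero hγ (le_max_right _ _) (max_le (le_of_lt hy) zero_le_one)).trans_lt ha

/-- Shrinking the argument changes the rate function little, uniformly on sublevel sets. -/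
lemma exists_rate_mul_le [IsProbabilityMeasure ν] {γ : ℝ} (hγ : IsPowerWeight ν γ) (C : ℝ) {ε : ℝ}
    (hε : 0 < ε) : ∃ δ : ℝ, 0 < δ ∧ δ < 1 ∧ ∀ x, rate ν x ≤ ENNReal.ofReal C →
      ∀ r, 1 - δ ≤ r → r ≤ 1 → rate ν (r * x) ≤ rate ν x + ENNReal.ofReal ε := by
  -- If `φ^W(0) = ∞`, sublevel sets are compact subsets of `(0, ∞)`, where the rate is continuous,
  -- so compactness makes `δ` uniform. If `φ^W(0)` is finite, convexity against the point `0` bounds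
  -- the increase by `(1 - r) φ^W(0)` for every `x`.
  by_cases h0 : rate ν 0 = ⊤
  · obtain ⟨M, hM0, hM⟩ := exists_le_rate hγ (C + 1)
    set K : Set ℝ := {x | rate ν x ≤ ENNReal.ofReal C} with hK
    have hpos : ∀ x ∈ K, 0 < x := fun x hx => by
      by_contra h
      have := (rate_zero_le hγ (not_lt.1 h)).trans hx
      rw [h0] at this
      exact ENNReal.ofReal_ne_top (top_le_iff.1 this)
    have hKc : IsCompact K := by
      refine (isCompact_Icc (a := (0 : ℝ)) (b := max M 1)).of_isClosed_subset
        (lowerSemicontinuous_rate.isClosed_preimage _) fun x hx => ⟨(hpos x hx).le, ?_⟩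
      by_contra! h
      have hx' : rate ν x ≤ ENNReal.ofReal C := hx
      have h1 := (hM x ((le_max_left _ _).trans h.le)).trans hx'
      rcases le_or_gt 0 C with hC | hC
      · have := (ENNReal.ofReal_le_ofReal_iff hC).1 h1
        linarith
      · rw [ENNReal.ofReal_of_nonpos hC.le] at hx'
        exact (rate_pos hγ (hpos x hx).le ((le_max_right _ _).trans_lt h).ne').ne'
          (nonpos_iff_eq_zero.1 hx')
    have hev : ∀ᶠ r in 𝓝 (1 : ℝ), ∀ x ∈ K, rate ν (r * x) ≤ rate ν x + ENNReal.ofReal ε := by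
      apply hKc.eventually_forall_of_forall_eventually
      intro x hx
      have hx0 := hpos x hx
      have c1 : Tendsto (fun z : ℝ × ℝ => rate ν (z.1 * z.2)) (𝓝 (1, x)) (𝓝 (rate ν x)) := by
        have : ContinuousAt (rate ν) ((1 : ℝ) * x) := by
          rw [one_mul]; exact continuousAt_rate hγ hx0
        have h2 := this.tendsto.comp (f := fun z : ℝ × ℝ => z.1 * z.2) (x := 𝓝 (1, x))
          ((continuous_fst.mul continuous_snd).tendsto (1, x))
        rwa [one_mul] at h2
      have c2 : Tendsto (fun z : ℝ × ℝ => rate ν z.2 + ENNReal.ofReal ε) (𝓝 (1, x))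
          (𝓝 (rate ν x + ENNReal.ofReal ε)) :=
        ((continuousAt_rate hγ hx0).tendsto.comp (continuous_snd.tendsto (1, x))).add
          tendsto_const_nhds
      have hne : rate ν x ≠ ⊤ := by rw [rate_of_pos hγ hx0]; exact ENNReal.ofReal_ne_top
      filter_upwards [c1.eventually_lt c2 (ENNReal.lt_add_right hne (by simpa using hε))] with z hz
        using hz.le
    obtain ⟨δ, hδ, hball⟩ := Metric.eventually_nhds_iff.1 hev
    refine ⟨min (δ / 2) (1 / 2), by positivity, by
      linarith [min_le_right (δ / 2) (1 / 2 : ℝ)], fun x hx r hr hr1 => hball ?_ x hx⟩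
    rw [Real.dist_eq, abs_lt]
    constructor <;> linarith [min_le_left (δ / 2) (1 / 2 : ℝ)]
  · refine ⟨min (ε / ((rate ν 0).toReal + 1)) (1 / 2), by positivity, by
      linarith [min_le_right (ε / ((rate ν 0).toReal + 1)) (1 / 2 : ℝ)],
      fun x _ r hr hr1 => ?_⟩
    have h2 := min_le_right (ε / ((rate ν 0).toReal + 1)) (1 / 2 : ℝ)
    have h1 := min_le_left (ε / ((rate ν 0).toReal + 1)) (1 / 2 : ℝ)
    refine (rate_mul_le (by linarith) hr1 x).trans (add_le_add le_rfl ?_)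
    rw [← ENNReal.ofReal_toReal h0, ← ENNReal.ofReal_mul (by linarith)]
    apply ENNReal.ofReal_le_ofReal
    have h3 : 1 - r ≤ ε / ((rate ν 0).toReal + 1) := by linarith
    rw [le_div_iff₀ (by positivity)] at h3
    nlinarith

/-! ### Exposing slopes -/

/-- The line `y ↦ t y - cgf t` lies below `φ_γ` on `(0, ∞)`. If it comes within `h ε / 2` of it at
`x`, comparison with the first-order expansion at `x + h` and `x - h` confines `t` to within `ε` of
the derivative. -/
lemma exists_slope_near [IsProbabilityMeasure ν] {γ : ℝ} (hγ : IsPowerWeight ν γ) {x : ℝ}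
    (hx : 0 < x) {ε : ℝ} (hε : 0 < ε) :
    ∃ t ∈ integrableExpSet id ν, |t - powerDeriv γ x| < ε ∧
      powerFun γ x - ε < t * x - cgf id ν t := by
  have hd := hasDerivAt_iff_isLittleO.1 (hasDerivAt_powerFun γ hx)
  have hd' := hd.def (show 0 < ε / 2 by positivity)
  obtain ⟨δ, hδ, hball⟩ := Metric.eventually_nhds_iff.1 hd'
  set h := min (δ / 2) (x / 2) with hh
  have hh0 : 0 < h := by positivity
  have h1 : h ≤ δ / 2 := min_le_left _ _
  have h2 : h ≤ x / 2 := min_le_right _ _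
  have hplus := hball (y := x + h) (by rw [Real.dist_eq, add_sub_cancel_left, abs_of_pos hh0]; linarith)
  have hminus := hball (y := x - h) (by
    rw [Real.dist_eq, sub_sub_cancel_left, abs_neg, abs_of_pos hh0]; linarith)
  simp only [add_sub_cancel_left, sub_sub_cancel_left, Real.norm_eq_abs, abs_neg, smul_eq_mul,
    abs_of_pos hh0] at hplus hminus
  have key : ∃ t ∈ integrableExpSet id ν,
      powerFun γ x - min (h * (ε / 2)) ε < t * x - cgf id ν t := by
    rcases le_or_gt 0 (powerFun γ x - min (h * (ε / 2)) ε) with hc | hc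
    · apply exists_lt_of_lt_rate hc
      rw [rate_of_pos hγ hx]
      apply (ENNReal.ofReal_lt_ofReal_iff_of_nonneg hc).2
      have : 0 < min (h * (ε / 2)) ε := by positivity
      linarith
    · exact ⟨0, zero_mem_integrableExpSet, by simpa using hc⟩
  obtain ⟨t, ht, hlt⟩ := key
  have hle : ∀ y, 0 < y → t * y - cgf id ν t ≤ powerFun γ y := fun y hy => by
    have := ofReal_le_rate ht y
    rw [rate_of_pos hγ hy] at this
    exact (ENNReal.ofReal_le_ofReal_iff (powerFun_nonneg hγ hy)).1 this
  have hp := hle (x + h) (by linarith)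
  have hm := hle (x - h) (by linarith)
  have m1 := min_le_left (h * (ε / 2)) ε
  have m2 := min_le_right (h * (ε / 2)) ε
  rw [abs_le] at hplus hminus
  refine ⟨t, ht, ?_, by linarith⟩
  rw [abs_lt]
  constructor
  · have : h * (-ε) < h * (t - powerDeriv γ x) := by nlinarith
    exact lt_of_mul_lt_mul_left this hh0.le
  · have : h * (t - powerDeriv γ x) < h * ε := by nlinarith
    exact lt_of_mul_lt_mul_left this hh0.le

/-- The domain of the moment generating function is an interval. It contains slopes close to the
derivatives at `x / 2` and at `2 x`, which strictly bracket the derivative at `x`. -/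
lemma powerDeriv_mem_interior [IsProbabilityMeasure ν] {γ : ℝ} (hγ : IsPowerWeight ν γ) {x : ℝ}
    (hx : 0 < x) : powerDeriv γ x ∈ interior (integrableExpSet id ν) := by
  have hl := powerDeriv_lt γ (half_pos hx) (half_lt_self hx)
  have hr := powerDeriv_lt γ hx (show x < 2 * x by linarith)
  obtain ⟨s, hs, hs', -⟩ := exists_slope_near hγ (half_pos hx) (sub_pos.2 hl)
  obtain ⟨t, ht, ht', -⟩ := exists_slope_near hγ (show 0 < 2 * x by linarith) (sub_pos.2 hr)
  rw [abs_lt] at hs' ht'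
  have hsub : Set.Ioo s t ⊆ integrableExpSet id ν := fun y hy =>
    (convex_integrableExpSet (X := id) (μ := ν)).ordConnected.out hs ht ⟨hy.1.le, hy.2.le⟩
  exact interior_maximal hsub isOpen_Ioo ⟨by linarith, by linarith⟩

/-- The rate function at `x > 0` is attained at the slope `φ_γ'(x)`, where the cumulant
generating function has derivative `x`. -/
lemma deriv_cgf_powerDeriv [IsProbabilityMeasure ν] {γ : ℝ} (hγ : IsPowerWeight ν γ) {x : ℝ}
    (hx : 0 < x) : deriv (cgf id ν) (powerDeriv γ x) = x := by
  set t₀ := powerDeriv γ x with ht₀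
  have hint := powerDeriv_mem_interior hγ hx
  have hdiff := (analyticAt_cgf hint).differentiableAt
  have hcont : ContinuousAt (fun t => t * x - cgf id ν t) t₀ :=
    (continuousAt_id.mul continuousAt_const).sub hdiff.continuousAt
  -- Nearly optimal slopes converge to `t₀`, so continuity of the cumulant generating function at
  -- `t₀` turns near-optimality into attainment.
  have hatt : powerFun γ x ≤ t₀ * x - cgf id ν t₀ := by
    by_contra! hlt
    obtain ⟨c, hc1, hc2⟩ := exists_between hlt
    obtain ⟨δ, hδ, hball⟩ := Metric.eventually_nhds_iff.1 (hcont.eventually (gt_mem_nhds hc1))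
    obtain ⟨t, -, ht1, ht2⟩ := exists_slope_near hγ hx (lt_min hδ (sub_pos.2 hc2))
    have := hball (y := t) (ht1.trans_le (min_le_left _ _))
    linarith [min_le_right δ (powerFun γ x - c)]
  have hmax : IsLocalMax (fun t => t * x - cgf id ν t) t₀ := by
    filter_upwards [mem_interior_iff_mem_nhds.1 hint] with t ht
    refine le_trans ?_ hatt
    have := ofReal_le_rate ht x
    rw [rate_of_pos hγ hx] at this
    exact (ENNReal.ofReal_le_ofReal_iff (powerFun_nonneg hγ hx)).1 this
  have hd : HasDerivAt (fun t => t * x - cgf id ν t) (1 * x - deriv (cgf id ν) t₀) t₀ :=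
    ((hasDerivAt_id t₀).mul_const x).sub hdiff.hasDerivAt
  linarith [hmax.hasDerivAt_eq_zero hd]

end

section

variable {ν : Measure ℝ} {Y : Type*} [Fintype Y]

/-! ### The scaled divergence on the simplex -/

/-- The divergence `φ^W(Q, P)` as an extended nonnegative real. -/
def rateDiv (ν : Measure ℝ) (Q P : Y → ℝ) : ENNReal :=
  ∑ k, ENNReal.ofReal (P k) * rate ν (Q k / P k)

lemma coe_ennreal_finset_sum {ι : Type*} (s : Finset ι) (f : ι → ENNReal) :
    ((∑ i ∈ s, f i : ENNReal) : EReal) = ∑ i ∈ s, (f i : EReal) :=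
  map_sum (⟨⟨(fun x : ENNReal => (x : EReal)), rfl⟩, EReal.coe_ennreal_add⟩ : ENNReal →+ EReal) f s

lemma coe_rateDiv [IsProbabilityMeasure ν] {P : Y → ℝ} (hP : ∀ k, 0 ≤ P k) (Q : Y → ℝ) :
    (rateDiv ν Q P : EReal) = divergence ν Q P := by
  rw [rateDiv, divergence, coe_ennreal_finset_sum]
  refine Finset.sum_congr rfl fun k _ => ?_
  rw [EReal.coe_ennreal_mul, EReal.coe_ennreal_ofReal, coe_rate, max_eq_left (hP k)]

lemma scaledDiv_le [IsProbabilityMeasure ν] {P : Y → ℝ} (hP : ∀ k, 0 ≤ P k) (Q : Y → ℝ) {m : ℝ}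
    (hm : m ≠ 0) : scaledDiv ν Q P ≤ rateDiv ν (m • Q) P := by
  rw [coe_rateDiv hP]
  exact iInf_le (fun m : {m : ℝ // m ≠ 0} => divergence ν (m.1 • Q) P) ⟨m, hm⟩

lemma le_scaledDiv [IsProbabilityMeasure ν] {P : Y → ℝ} (hP : ∀ k, 0 ≤ P k) (Q : Y → ℝ) {c : EReal}
    (h : ∀ m : ℝ, m ≠ 0 → c ≤ rateDiv ν (m • Q) P) : c ≤ scaledDiv ν Q P :=
  le_iInf fun m => by rw [← coe_rateDiv hP]; exact h m.1 m.2

lemma scaledDiv_nonneg [IsProbabilityMeasure ν] {P : Y → ℝ} (hP : ∀ k, 0 ≤ P k) (Q : Y → ℝ) :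
    0 ≤ scaledDiv ν Q P :=
  le_scaledDiv hP Q fun _ _ => EReal.coe_ennreal_nonneg _

lemma rate_sum_le_rateDiv [IsProbabilityMeasure ν] {P : Y → ℝ} (hP : P ∈ stdSimplex ℝ Y)
    (hpos : ∀ k, 0 < P k) (Q : Y → ℝ) : rate ν (∑ k, Q k) ≤ rateDiv ν Q P := by
  have := rate_sum_le (ν := ν) hP fun k => Q k / P k
  have h : ∑ k, P k * (Q k / P k) = ∑ k, Q k :=
    Finset.sum_congr rfl fun k _ => mul_div_cancel₀ _ (hpos k).ne'
  rwa [h] at this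

lemma rate_le_rateDiv_smul [IsProbabilityMeasure ν] {P Q : Y → ℝ} (hP : P ∈ stdSimplex ℝ Y)
    (hpos : ∀ k, 0 < P k) (hQ : Q ∈ stdSimplex ℝ Y) (m : ℝ) :
    rate ν m ≤ rateDiv ν (m • Q) P := by
  have := rate_sum_le_rateDiv (ν := ν) hP hpos (m • Q)
  simpa [← Finset.mul_sum, hQ.2] using this

lemma sum_ofReal_eq_one {P : Y → ℝ} (hP : P ∈ stdSimplex ℝ Y) : ∑ k, ENNReal.ofReal (P k) = 1 := by
  rw [← ENNReal.ofReal_sum_of_nonneg fun k _ => hP.1 k, hP.2, ENNReal.ofReal_one]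

lemma rateDiv_zero {P : Y → ℝ} (hP : P ∈ stdSimplex ℝ Y) :
    rateDiv ν 0 P = rate ν 0 := by
  simp [rateDiv, ← Finset.sum_mul, sum_ofReal_eq_one hP]

lemma rateDiv_self {γ : ℝ} (hγ : IsPowerWeight ν γ) {P : Y → ℝ} (hpos : ∀ k, 0 < P k) :
    rateDiv ν P P = 0 := by
  simp [rateDiv, div_self (hpos _).ne', rate_one hγ]

lemma rateDiv_mix_le [IsProbabilityMeasure ν] {γ : ℝ} (hγ : IsPowerWeight ν γ) {P : Y → ℝ}
    (hpos : ∀ k, 0 < P k) (Q : Y → ℝ) {r : ℝ} (hr : 0 ≤ r) (hr1 : r ≤ 1) :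
    rateDiv ν (r • Q + (1 - r) • P) P ≤ ENNReal.ofReal r * rateDiv ν Q P := by
  rw [rateDiv, rateDiv, Finset.mul_sum]
  refine Finset.sum_le_sum fun k _ => ?_
  have h : (r • Q + (1 - r) • P) k / P k = r * (Q k / P k) + (1 - r) := by
    have := (hpos k).ne'
    simp only [Pi.add_apply, Pi.smul_apply, smul_eq_mul]
    field_simp
  rw [h, mul_left_comm]
  gcongr
  exact rate_toward_one_le hγ hr hr1 _

lemma exists_small_multiple {P : Y → ℝ} (hpos : ∀ k, 0 < P k) {Q : Y → ℝ}
    (hQ : Q ∈ stdSimplex ℝ Y) : ∃ m : ℝ, 0 < m ∧ ∀ k, m * Q k / P k ≤ 1 := by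
  have : Nonempty Y := by
    by_contra h
    rw [not_nonempty_iff] at h
    simpa using hQ.2
  obtain ⟨k₀, hk₀⟩ := Finite.exists_min P
  refine ⟨P k₀, hpos k₀, fun k => ?_⟩
  rw [div_le_one (hpos k)]
  have : Q k ≤ 1 := hQ.2 ▸ Finset.single_le_sum (fun i _ => hQ.1 i) (Finset.mem_univ k)
  nlinarith [hk₀ k, hpos k₀, hQ.1 k]

/-- A small multiple puts all ratios in `[0, 1]`, where the rate is at most `φ^W(0)`. Thus excluding
`m = 0` from the infimum loses nothing. -/
lemma exists_rateDiv_smul_le_rate_zero [IsProbabilityMeasure ν] {γ : ℝ} (hγ : IsPowerWeight ν γ)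
    {P Q : Y → ℝ} (hP : P ∈ stdSimplex ℝ Y) (hpos : ∀ k, 0 < P k) (hQ : Q ∈ stdSimplex ℝ Y) :
    ∃ m : ℝ, 0 < m ∧ rateDiv ν (m • Q) P ≤ rate ν 0 := by
  obtain ⟨m, hm, h⟩ := exists_small_multiple hpos hQ
  refine ⟨m, hm, ?_⟩
  rw [← rateDiv_zero hP]
  refine Finset.sum_le_sum fun k _ => ?_
  gcongr
  simp only [Pi.zero_apply, zero_div]
  exact rate_le_zero hγ (div_nonneg (mul_nonneg hm.le (hQ.1 k)) (hpos k).le) (h k)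

lemma exists_rateDiv_smul_lt_rate_zero [IsProbabilityMeasure ν] {γ : ℝ} (hγ : IsPowerWeight ν γ)
    {P Q : Y → ℝ} (hP : P ∈ stdSimplex ℝ Y) (hpos : ∀ k, 0 < P k) (hQ : Q ∈ stdSimplex ℝ Y)
    (hQpos : ∀ k, 0 < Q k) :
    ∃ m : ℝ, 0 < m ∧ rateDiv ν (m • Q) P < rate ν 0 := by
  have : Nonempty Y := by
    by_contra h
    rw [not_nonempty_iff] at h
    simpa using hQ.2
  obtain ⟨m, hm, h⟩ := exists_small_multiple hpos hQ
  refine ⟨m, hm, ?_⟩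
  rw [← rateDiv_zero hP]
  refine ENNReal.sum_lt_sum_of_nonempty Finset.univ_nonempty fun k _ => ?_
  refine ENNReal.mul_lt_mul_right (by simpa using hpos k) ENNReal.ofReal_ne_top ?_
  simp only [Pi.zero_apply, zero_div]
  exact rate_lt_zero hγ (div_pos (mul_pos hm (hQpos k)) (hpos k)) (h k)

lemma scaledDiv_le_rate_zero [IsProbabilityMeasure ν] {γ : ℝ} (hγ : IsPowerWeight ν γ)
    {P Q : Y → ℝ} (hP : P ∈ stdSimplex ℝ Y) (hpos : ∀ k, 0 < P k) (hQ : Q ∈ stdSimplex ℝ Y) :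
    scaledDiv ν Q P ≤ rate ν 0 := by
  obtain ⟨m, hm, h⟩ := exists_rateDiv_smul_le_rate_zero hγ hP hpos hQ
  exact (scaledDiv_le hP.1 Q hm.ne').trans (EReal.coe_ennreal_le_coe_ennreal_iff.2 h)

lemma rate_zero_le_rateDiv_smul [IsProbabilityMeasure ν] {γ : ℝ} (hγ : IsPowerWeight ν γ)
    {P Q : Y → ℝ} (hP : P ∈ stdSimplex ℝ Y) (hpos : ∀ k, 0 < P k) (hQ : Q ∈ stdSimplex ℝ Y)
    {m : ℝ} (hm : m ≤ 0) : rate ν 0 ≤ rateDiv ν (m • Q) P :=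
  (rate_zero_le hγ hm).trans (rate_le_rateDiv_smul hP hpos hQ m)

/-- On the simplex only positive multiples matter in the scaled divergence. -/
lemma exists_pos_multiple [IsProbabilityMeasure ν] {γ : ℝ} (hγ : IsPowerWeight ν γ)
    {P Q : Y → ℝ} (hP : P ∈ stdSimplex ℝ Y) (hpos : ∀ k, 0 < P k) (hQ : Q ∈ stdSimplex ℝ Y)
    {c : EReal} (h : scaledDiv ν Q P < c) :
    ∃ m : ℝ, 0 < m ∧ (rateDiv ν (m • Q) P : EReal) < c := by
  obtain ⟨⟨m, hm⟩, hlt⟩ := iInf_lt_iff.1 h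
  rw [← coe_rateDiv hP.1] at hlt
  rcases lt_or_gt_of_ne hm with hm | hm
  · obtain ⟨m', hm', h'⟩ := exists_rateDiv_smul_le_rate_zero hγ hP hpos hQ
    exact ⟨m', hm', (EReal.coe_ennreal_le_coe_ennreal_iff.2
      (h'.trans (rate_zero_le_rateDiv_smul hγ hP hpos hQ hm.le))).trans_lt hlt⟩
  · exact ⟨m, hm, hlt⟩

/-- A jointly continuous function that is `φ^W(mQ, P)` for `m ≥ 0` and `Q` in the simplex. -/
def rateDivPos (ν : Measure ℝ) (P : Y → ℝ) (z : (Y → ℝ) × ℝ) : ENNReal :=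
  ∑ k, ENNReal.ofReal (P k) * rate ν (max (z.2 * z.1 k / P k) 0)

lemma rateDivPos_eq {P Q : Y → ℝ} (hpos : ∀ k, 0 < P k)
    (hQ : Q ∈ stdSimplex ℝ Y) {m : ℝ} (hm : 0 ≤ m) :
    rateDivPos ν P (Q, m) = rateDiv ν (m • Q) P := by
  refine Finset.sum_congr rfl fun k _ => ?_
  rw [max_eq_left (div_nonneg (mul_nonneg hm (hQ.1 k)) (hpos k).le)]
  rfl

lemma continuous_rateDivPos [IsProbabilityMeasure ν] {γ : ℝ} (hγ : IsPowerWeight ν γ)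
    (P : Y → ℝ) : Continuous (rateDivPos ν P) := by
  refine continuous_finsetSum _ fun k _ => ?_
  refine (ENNReal.continuous_const_mul ENNReal.ofReal_ne_top).comp ?_
  exact (continuous_rate_max hγ).comp (by fun_prop : Continuous fun z : (Y → ℝ) × ℝ => z.2 * z.1 k / P k)

/-- Upper semicontinuity needs one good multiple. For lower semicontinuity the multiples are reduced
to a compact interval `[0, M]`: beyond `M` coercivity takes over through Jensen's inequality, and
multiples `m ≤ 0` cost at least the value at `m = 0`. -/
lemma continuousOn_scaledDiv [IsProbabilityMeasure ν] {γ : ℝ} (hγ : IsPowerWeight ν γ)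
    {P : Y → ℝ} (hP : P ∈ stdSimplex ℝ Y) (hpos : ∀ k, 0 < P k) :
    ContinuousOn (fun Q => scaledDiv ν Q P) (stdSimplex ℝ Y) := by
  intro Q hQ
  have hF := continuous_rateDivPos hγ P
  refine tendsto_order.2 ⟨fun a ha => ?_, fun a ha => ?_⟩
  · rcases lt_or_ge a 0 with ha0 | ha0
    · exact Eventually.of_forall fun R => ha0.trans_le (scaledDiv_nonneg hP.1 R)
    obtain ⟨b, hab, hb⟩ := EReal.lt_iff_exists_real_btwn.1 ha
    have hb0 : 0 ≤ b := by exact_mod_cast (ha0.trans_lt hab).le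
    have hcoe : ((ENNReal.ofReal b : ENNReal) : EReal) = b := by
      rw [EReal.coe_ennreal_ofReal, max_eq_left hb0]
    obtain ⟨M, hM0, hM⟩ := exists_le_rate hγ b
    have hev : ∀ᶠ R in 𝓝 Q, ∀ m ∈ Set.Icc 0 M, ENNReal.ofReal b < rateDivPos ν P (R, m) := by
      apply isCompact_Icc.eventually_forall_of_forall_eventually
      intro m hm
      refine hF.continuousAt.eventually (lt_mem_nhds ?_)
      rw [rateDivPos_eq hpos hQ hm.1, ← EReal.coe_ennreal_lt_coe_ennreal_iff, hcoe]
      refine hb.trans_le ?_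
      rcases hm.1.eq_or_lt with rfl | hm0
      · rw [zero_smul, rateDiv_zero hP]
        exact scaledDiv_le_rate_zero hγ hP hpos hQ
      · exact scaledDiv_le hP.1 Q hm0.ne'
    filter_upwards [mem_nhdsWithin_of_mem_nhds hev, self_mem_nhdsWithin] with R hR hRs
    refine hab.trans_le (le_scaledDiv hP.1 R fun m _ => ?_)
    rw [← hcoe, EReal.coe_ennreal_le_coe_ennreal_iff]
    rcases le_or_gt m 0 with hm | hm
    · have h0 := hR 0 ⟨le_rfl, hM0.le⟩
      rw [rateDivPos_eq hpos hRs le_rfl, zero_smul, rateDiv_zero hP] at h0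
      exact h0.le.trans (rate_zero_le_rateDiv_smul hγ hP hpos hRs hm)
    · rcases le_or_gt m M with hmM | hmM
      · have h0 := hR m ⟨hm.le, hmM⟩
        rw [rateDivPos_eq hpos hRs hm.le] at h0
        exact h0.le
      · exact (hM m hmM.le).trans (rate_le_rateDiv_smul hP hpos hRs m)
  · obtain ⟨m, hm, hlt⟩ := exists_pos_multiple hγ hP hpos hQ ha
    have hc : Tendsto (fun R => ((rateDivPos ν P (R, m) : ENNReal) : EReal)) (𝓝 Q)
        (𝓝 (rateDivPos ν P (Q, m) : ENNReal)) :=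
      (continuous_coe_ennreal_ereal.comp (hF.comp (by fun_prop))).tendsto Q
    rw [← rateDivPos_eq hpos hQ hm.le] at hlt
    filter_upwards [mem_nhdsWithin_of_mem_nhds (hc.eventually (gt_mem_nhds hlt)),
      self_mem_nhdsWithin] with R hR hRs
    rw [rateDivPos_eq hpos hRs hm.le] at hR
    exact (scaledDiv_le hP.1 R hm.ne').trans_lt hR

/-- At a positive point of the simplex the scaled divergence is attained at a positive multiple. -/
lemma exists_minimizer [IsProbabilityMeasure ν] {γ : ℝ} (hγ : IsPowerWeight ν γ)
    {P Q : Y → ℝ} (hP : P ∈ stdSimplex ℝ Y) (hpos : ∀ k, 0 < P k) (hQ : Q ∈ stdSimplex ℝ Y)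
    (hQpos : ∀ k, 0 < Q k) :
    ∃ m : ℝ, 0 < m ∧ scaledDiv ν Q P = rateDiv ν (m • Q) P ∧ rateDiv ν (m • Q) P ≠ ⊤ := by
  have hfin : ∀ m : ℝ, 0 < m → rateDiv ν (m • Q) P ≠ ⊤ := fun m hm => by
    refine ENNReal.sum_ne_top.2 fun k _ => ENNReal.mul_ne_top ENNReal.ofReal_ne_top ?_
    rw [Pi.smul_apply, smul_eq_mul, rate_of_pos hγ (div_pos (mul_pos hm (hQpos k)) (hpos k))]
    exact ENNReal.ofReal_ne_top
  obtain ⟨m₁, hm₁, hlt⟩ := exists_rateDiv_smul_lt_rate_zero hγ hP hpos hQ hQpos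
  obtain ⟨M, hM0, hM⟩ := exists_le_rate hγ (rateDiv ν (m₁ • Q) P).toReal
  rw [ENNReal.ofReal_toReal (hfin m₁ hm₁)] at hM
  have hF : Continuous fun m : ℝ => rateDivPos ν P (Q, m) :=
    (continuous_rateDivPos hγ P).comp (by fun_prop)
  -- The interval includes `0`, where the value is `φ^W(0)`; the strictly smaller value at `m₁`
  -- keeps the minimizer away from it.
  obtain ⟨m₀, hm₀, hmin⟩ := (isCompact_Icc (a := (0 : ℝ)) (b := max M m₁)).exists_isMinOn
    ⟨0, le_rfl, hM0.le.trans (le_max_left _ _)⟩ hF.continuousOn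
  have hmin' : ∀ m, 0 ≤ m → m ≤ max M m₁ → rateDiv ν (m₀ • Q) P ≤ rateDiv ν (m • Q) P := by
    intro m h1 h2
    have := hmin ⟨h1, h2⟩
    change rateDivPos ν P (Q, m₀) ≤ rateDivPos ν P (Q, m) at this
    rwa [rateDivPos_eq hpos hQ hm₀.1, rateDivPos_eq hpos hQ h1] at this
  have hle₁ := hmin' m₁ hm₁.le (le_max_right _ _)
  have hpos₀ : 0 < m₀ := by
    refine lt_of_le_of_ne hm₀.1 fun h => ?_
    rw [← h, zero_smul, rateDiv_zero hP] at hle₁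
    exact absurd hlt (not_lt.2 hle₁)
  refine ⟨m₀, hpos₀, le_antisymm (scaledDiv_le hP.1 Q hpos₀.ne') (le_scaledDiv hP.1 Q fun m _ => ?_),
    hfin m₀ hpos₀⟩
  rw [EReal.coe_ennreal_le_coe_ennreal_iff]
  rcases le_or_gt m 0 with hm | hm
  · exact (hle₁.trans hlt.le).trans (rate_zero_le_rateDiv_smul hγ hP hpos hQ hm)
  · rcases le_or_gt m (max M m₁) with h | h
    · exact hmin' m hm.le h
    · exact hle₁.trans ((hM m ((le_max_left _ _).trans h.le)).trans
        (rate_le_rateDiv_smul hP hpos hQ m))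

lemma rateDiv_smul_ne_zero [IsProbabilityMeasure ν] {γ : ℝ} (hγ : IsPowerWeight ν γ)
    {P Q : Y → ℝ} (hP : P ∈ stdSimplex ℝ Y) (hpos : ∀ k, 0 < P k) (hQ : Q ∈ stdSimplex ℝ Y)
    (hne : Q ≠ P) {m : ℝ} (hm : 0 < m) : rateDiv ν (m • Q) P ≠ 0 := by
  intro h
  have h1 : ∀ k, m * Q k = P k := fun k => by
    have := (Finset.sum_eq_zero_iff.1 h) k (Finset.mem_univ k)
    rw [mul_eq_zero, ENNReal.ofReal_eq_zero, or_iff_right (not_le.2 (hpos k))] at this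
    by_contra hk
    refine (rate_pos hγ (div_nonneg (mul_nonneg hm.le (hQ.1 k)) (hpos k).le) ?_).ne' this
    intro h
    exact hk ((div_eq_one_iff_eq (hpos k).ne').1 h)
  have h2 : m = 1 := by
    have : ∑ k, m * Q k = ∑ k, P k := Finset.sum_congr rfl fun k _ => h1 k
    rwa [← Finset.mul_sum, hQ.2, hP.2, mul_one] at this
  exact hne (funext fun k => by rw [← h1 k, h2, one_mul])

/-- Moving away from `P` along a ray strictly increases the scaled divergence. -/
lemma scaledDiv_lt_of_ray [IsProbabilityMeasure ν] {γ : ℝ} (hγ : IsPowerWeight ν γ)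
    {P Q R : Y → ℝ} (hP : P ∈ stdSimplex ℝ Y) (hpos : ∀ k, 0 < P k) (hQ : Q ∈ stdSimplex ℝ Y)
    (hQpos : ∀ k, 0 < Q k) (hne : Q ≠ P) {ε : ℝ} (hε : 0 < ε)
    (hR : ∀ k, (1 + ε) * R k = Q k + ε * P k) : scaledDiv ν R P < scaledDiv ν Q P := by
  obtain ⟨m, hm, heq, hfin⟩ := exists_minimizer hγ hP hpos hQ hQpos
  have hne0 := rateDiv_smul_ne_zero hγ hP hpos hQ hne hm
  -- The weight for which the mixture of `mQ` and `P` is a multiple of `R`. Strictness comes from `r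
  -- < 1` and a divergence that is neither `0` nor infinite.
  set r := 1 / (1 + ε * m) with hr
  have hden : 0 < 1 + ε * m := by positivity
  have hr0 : 0 ≤ r := by positivity
  have hr1 : r < 1 := by
    rw [hr, div_lt_one hden]
    have := mul_pos hε hm
    linarith
  have hmix : r • (m • Q) + (1 - r) • P = (m * (1 + ε) / (1 + ε * m)) • R := by
    funext k
    simp only [Pi.add_apply, Pi.smul_apply, smul_eq_mul]
    rw [mul_div_right_comm, mul_assoc, hR k, hr]
    field_simp
    ring
  have hm' : m * (1 + ε) / (1 + ε * m) ≠ 0 := by positivity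
  refine (scaledDiv_le hP.1 R hm').trans_lt ?_
  rw [heq, EReal.coe_ennreal_lt_coe_ennreal_iff, ← hmix]
  refine (rateDiv_mix_le hγ hpos _ hr0 hr1.le).trans_lt ?_
  conv_rhs => rw [← one_mul (rateDiv ν (m • Q) P)]
  exact ENNReal.mul_lt_mul_left hne0 hfin (by rwa [ENNReal.ofReal_lt_one])

lemma mem_closure_exceedSet_divStat [IsProbabilityMeasure ν] {γ : ℝ} (hγ : IsPowerWeight ν γ)
    {P R : Y → ℝ} (hP : P ∈ stdSimplex ℝ Y) (hpos : ∀ k, 0 < P k) (hR : R ∈ stdSimplex ℝ Y)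
    (hRpos : ∀ k, 0 < R k) (hne : R ≠ P) :
    R ∈ closure (exceedSet (divStat ν P) R) := by
  have hcont : Continuous fun ε : ℝ => R + ε • (R - P) := by fun_prop
  have hlim : Tendsto (fun ε : ℝ => R + ε • (R - P)) (𝓝[>] 0) (𝓝 R) := by
    have := hcont.tendsto 0
    rw [zero_smul, add_zero] at this
    exact this.mono_left nhdsWithin_le_nhds
  refine mem_closure_of_tendsto hlim ?_
  have hev : ∀ᶠ ε in 𝓝[>] (0 : ℝ), ∀ k, 0 < (R + ε • (R - P)) k := by
    rw [eventually_all]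
    intro k
    exact ((tendsto_pi_nhds.1 hlim) k).eventually (lt_mem_nhds (hRpos k))
  filter_upwards [hev, self_mem_nhdsWithin] with ε hε hε0
  have hε0 : 0 < ε := hε0
  have hs : R + ε • (R - P) ∈ stdSimplex ℝ Y := by
    refine ⟨fun k => (hε k).le, ?_⟩
    simp [Finset.sum_add_distrib, ← Finset.mul_sum, Finset.sum_sub_distrib, hR.2, hP.2]
  refine ⟨hs, scaledDiv_lt_of_ray hγ hP hpos hs hε (fun h => hne ?_) hε0 fun k => ?_⟩
  · have : (1 + ε) • (R - P) = 0 := by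
      rw [add_smul, one_smul, sub_add_eq_add_sub, h, sub_self]
    rcases smul_eq_zero.1 this with h | h
    · linarith
    · exact sub_eq_zero.1 h
  · simp only [Pi.add_apply, Pi.smul_apply, Pi.sub_apply, smul_eq_mul]
    ring

/-- Points of the simplex can be perturbed to positive points without increasing the divergence. -/
lemma exists_pos_near [IsProbabilityMeasure ν] {γ : ℝ} (hγ : IsPowerWeight ν γ)
    {P Q : Y → ℝ} (hP : P ∈ stdSimplex ℝ Y) (hpos : ∀ k, 0 < P k) (hQ : Q ∈ stdSimplex ℝ Y)
    {m : ℝ} (hm : 0 < m) {U : Set (Y → ℝ)} (hU : U ∈ 𝓝 Q) :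
    ∃ R ∈ U, R ∈ stdSimplex ℝ Y ∧ (∀ k, 0 < R k) ∧
      ∃ m' : ℝ, 0 < m' ∧ rateDiv ν (m' • R) P ≤ rateDiv ν (m • Q) P := by
  -- Mixing `mQ` with `P` makes every entry positive and does not increase the divergence; the
  -- mixture has total mass `r m + (1 - r)`, by which it is normalized.
  set f : ℝ → Y → ℝ := fun r => (r * m + (1 - r))⁻¹ • (r • (m • Q) + (1 - r) • P) with hf
  have hcont : ContinuousAt f 1 := by
    have h1 : ContinuousAt (fun r : ℝ => (r * m + (1 - r))⁻¹) 1 :=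
      ContinuousAt.inv₀ (by fun_prop) (by simpa using hm.ne')
    exact h1.smul (by fun_prop)
  have h1 : f 1 = Q := by
    simp [hf, smul_smul, hm.ne']
  have hev : ∀ᶠ r in 𝓝[<] (1 : ℝ), f r ∈ U :=
    (hcont.tendsto.mono_left nhdsWithin_le_nhds).eventually (by rw [h1]; exact hU)
  have hev' : ∀ᶠ r in 𝓝[<] (1 : ℝ), r ∈ Set.Ioo 0 1 := Ioo_mem_nhdsLT one_pos
  obtain ⟨r, hrU, hr0, hr1⟩ := (hev.and hev').exists
  have h1r : 0 < 1 - r := by linarith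
  have hc : 0 < r * m + (1 - r) := by positivity
  have hposk : ∀ k, 0 < f r k := fun k => by
    simp only [hf, Pi.add_apply, Pi.smul_apply, smul_eq_mul]
    have := hQ.1 k
    have := hpos k
    positivity
  refine ⟨f r, hrU, ⟨fun k => (hposk k).le, ?_⟩, hposk, r * m + (1 - r), hc, ?_⟩
  · simp only [hf, Pi.add_apply, Pi.smul_apply, smul_eq_mul, ← Finset.mul_sum,
      Finset.sum_add_distrib, hQ.2, hP.2, mul_one]
    exact inv_mul_cancel₀ hc.ne'
  · rw [hf, smul_inv_smul₀ hc.ne']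
    refine (rateDiv_mix_le hγ hpos _ hr0.le hr1.le).trans ?_
    exact mul_le_of_le_one_left' (ENNReal.ofReal_le_one.2 hr1.le)

end

section

variable {ν : Measure ℝ} {Ω : Type*} [MeasurableSpace Ω] {μ : Measure Ω}

/-! ### Sums of independent weights over blocks -/

/-- Sums over disjoint blocks of an independent family are independent. -/
lemma iIndepFun_block_sums {ι κ : Type*} {W : ι → Ω → ℝ} (hW : ∀ i, Measurable (W i))
    (hind : iIndepFun W μ) (s : κ → Finset ι) (hs : Pairwise fun j k => Disjoint (s j) (s k)) :
    iIndepFun (fun k ω => ∑ i ∈ s k, W i ω) μ := by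
  classical
  have : IsProbabilityMeasure μ := hind.isProbabilityMeasure
  rw [iIndepFun_iff_measure_inter_preimage_eq_mul]
  intro S A hA
  induction S using Finset.induction_on with
  | empty => simp
  | insert k S hk ih =>
    rw [Finset.set_biInter_insert, Finset.prod_insert hk,
      ← ih fun j hj => hA j (Finset.mem_insert_of_mem hj)]
    have hdisj : Disjoint (s k) (S.biUnion s) := by
      rw [Finset.disjoint_biUnion_right]
      intro j hj
      exact hs fun h => hk (h ▸ hj)
    have hI := hind.indepFun_finset (s k) (S.biUnion s) hdisj hW
    let T := S.biUnion s
    -- Extension by zero lets all the sums over the blocks in `T` be read off one vector indexed by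
    -- `T`.
    let ext : (T → ℝ) → ι → ℝ := fun v i => if h : i ∈ T then v ⟨i, h⟩ else 0
    have hext : ∀ i, Measurable fun v => ext v i := fun i => by
      by_cases h : i ∈ T
      · simpa [ext, h] using measurable_pi_apply _
      · simp [ext, h]
    have e1 : (fun ω => ∑ i ∈ s k, W i ω) ⁻¹' A k =
        (fun ω (i : s k) => W i ω) ⁻¹' {v | ∑ i, v i ∈ A k} := by
      ext ω
      simp only [Set.mem_preimage, Set.mem_ofPred_eq]
      rw [Finset.sum_coe_sort (s k) fun i => W i ω]
    have e2 : (⋂ j ∈ S, (fun ω => ∑ i ∈ s j, W i ω) ⁻¹' A j) =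
        (fun ω (i : T) => W i ω) ⁻¹' (⋂ j ∈ S, {v | ∑ i ∈ s j, ext v i ∈ A j}) := by
      ext ω
      simp only [Set.mem_iInter, Set.mem_preimage, Set.mem_ofPred_eq]
      refine forall₂_congr fun j hj => ?_
      rw [Finset.sum_congr rfl fun i hi => ?_]
      simp only [ext]
      rw [dif_pos (Finset.mem_biUnion.2 ⟨j, hj, hi⟩)]
    rw [e1, e2]
    refine hI.measure_inter_preimage_eq_mul _ _ ?_ ?_
    · exact (Finset.measurable_sum _ fun i _ => measurable_pi_apply i)
        (hA k (Finset.mem_insert_self _ _))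
    · refine Finset.measurableSet_biInter _ fun j hj => ?_
      exact (Finset.measurable_sum _ fun i _ => hext i) (hA j (Finset.mem_insert_of_mem hj))

lemma integrable_exp_weight {W : ℕ → Ω → ℝ} (hW : ∀ i, Measurable (W i))
    (hlaw : ∀ i, μ.map (W i) = ν) {t : ℝ} (ht : t ∈ integrableExpSet id ν) (i : ℕ) :
    Integrable (fun ω => Real.exp (t * W i ω)) μ := by
  have h : Integrable (fun w : ℝ => Real.exp (t * w)) (μ.map (W i)) := by rw [hlaw i]; exact ht
  exact h.comp_measurable (hW i)

lemma cgf_weight {W : ℕ → Ω → ℝ} (hW : ∀ i, Measurable (W i))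
    (hlaw : ∀ i, μ.map (W i) = ν) (t : ℝ) (i : ℕ) : cgf (W i) μ t = cgf id ν t := by
  rw [cgf, cgf, ← hlaw i, mgf_id_map (hW i).aemeasurable]

lemma integrable_exp_sum {W : ℕ → Ω → ℝ} (hW : ∀ i, Measurable (W i))
    (hlaw : ∀ i, μ.map (W i) = ν) (hind : iIndepFun W μ) (s : Finset ℕ) {t : ℝ}
    (ht : t ∈ integrableExpSet id ν) :
    Integrable (fun ω => Real.exp (t * ∑ i ∈ s, W i ω)) μ := by
  have : IsProbabilityMeasure μ := hind.isProbabilityMeasure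
  simpa using hind.integrable_exp_mul_sum hW (s := s)
    fun i _ => integrable_exp_weight hW hlaw ht i

lemma cgf_sum_weights {W : ℕ → Ω → ℝ} (hW : ∀ i, Measurable (W i))
    (hlaw : ∀ i, μ.map (W i) = ν) (hind : iIndepFun W μ) (s : Finset ℕ) {t : ℝ}
    (ht : t ∈ integrableExpSet id ν) :
    cgf (fun ω => ∑ i ∈ s, W i ω) μ t = s.card * cgf id ν t := by
  have h := hind.cgf_sum hW (s := s) fun i _ => integrable_exp_weight hW hlaw ht i
  rw [Finset.sum_fn] at h
  rw [h, Finset.sum_congr rfl fun i _ => cgf_weight hW hlaw t i]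
  simp

/-- **Cramér's lower bound** at a positive point, uniformly over blocks. -/
lemma cramer_lower [IsProbabilityMeasure ν] {γ : ℝ} (hγ : IsPowerWeight ν γ) {W : ℕ → Ω → ℝ}
    (hW : ∀ i, Measurable (W i)) (hlaw : ∀ i, μ.map (W i) = ν) (hind : iIndepFun W μ) {x : ℝ}
    (hx : 0 < x) {δ ε : ℝ} (hδ : 0 < δ) (hε : 0 < ε) :
    ∃ N₀ : ℕ, ∀ s : Finset ℕ, N₀ ≤ s.card →
      ENNReal.ofReal (1 / 2 * Real.exp (-(s.card * (powerFun γ x + ε)))) ≤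
        μ {ω | |∑ i ∈ s, W i ω - s.card * x| < s.card * δ} := by
  have : IsProbabilityMeasure μ := hind.isProbabilityMeasure
  set t := powerDeriv γ x with htdef
  have htint : t ∈ interior (integrableExpSet id ν) := powerDeriv_mem_interior hγ hx
  have htD := interior_subset htint
  set σ2 := iteratedDeriv 2 (cgf id ν) t with hσ2
  -- The window is narrowed so that the exponent `t S` varies by at most `N ε` over it.
  set δ' := min δ (ε / (|t| + 1)) with hδ'
  have hδ'0 : 0 < δ' := by positivity
  have htδ : |t| * δ' ≤ ε := by
    have h1 : δ' ≤ ε / (|t| + 1) := min_le_right _ _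
    rw [le_div_iff₀ (by positivity)] at h1
    nlinarith
  -- Chebyshev's bound `N σ2 / (N δ')²` is then at most `1/2`; the `+ 1` excludes empty blocks.
  refine ⟨⌈2 * σ2 / δ' ^ 2⌉₊ + 1, fun s hs => ?_⟩
  set S : Ω → ℝ := fun ω => ∑ i ∈ s, W i ω with hS
  have hSm : Measurable S := Finset.measurable_sum _ fun i _ => hW i
  set N : ℝ := (s.card : ℝ) with hN
  have hN1 : 2 * σ2 / δ' ^ 2 ≤ N := by
    refine (Nat.le_ceil _).trans ?_
    rw [hN]
    exact_mod_cast (Nat.le_succ _).trans hs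
  have hN0 : 0 < N := by
    have : 0 < s.card := by omega
    rw [hN]
    exact_mod_cast this
  have hsub : integrableExpSet id ν ⊆ integrableExpSet S μ := fun u hu =>
    integrable_exp_sum hW hlaw hind s hu
  have hcgf : cgf S μ =ᶠ[𝓝 t] fun u => N * cgf id ν u := by
    filter_upwards [mem_interior_iff_mem_nhds.1 htint] with u hu
      using cgf_sum_weights hW hlaw hind s hu
  have htS := interior_mono hsub htint
  -- Tilting by the slope where the cumulant generating function has derivative `x` makes the rare
  -- value typical.
  have hmean : (μ.tilted (t * S ·))[S] = N * x := by
    rw [integral_tilted_mul_self htS, hcgf.deriv_eq, deriv_const_mul_field,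
      deriv_cgf_powerDeriv hγ hx]
  have hvar : Var[S; μ.tilted (t * S ·)] = N * σ2 := by
    rw [variance_tilted_mul htS, hcgf.iteratedDeriv_eq, iteratedDeriv_const_mul_field]
  have hexpint : Integrable (fun ω => Real.exp (t * S ω)) μ := hsub htD
  have : IsProbabilityMeasure (μ.tilted (t * S ·)) := isProbabilityMeasure_tilted hexpint
  set B : Set Ω := {ω | |S ω - N * x| < N * δ'} with hB
  have hBm : MeasurableSet B := measurableSet_lt (by fun_prop) (by fun_prop)
  have hcompl : μ.tilted (t * S ·) Bᶜ ≤ ENNReal.ofReal (1 / 2) := by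
    have h := meas_ge_le_variance_div_sq (memLp_tilted_mul htS 2) (mul_pos hN0 hδ'0)
    rw [hmean, hvar] at h
    have hBc : Bᶜ = {ω | N * δ' ≤ |S ω - N * x|} := by ext ω; simp [hB]
    rw [hBc]
    refine h.trans (ENNReal.ofReal_le_ofReal ?_)
    rw [div_le_iff₀ (by positivity)] at hN1 ⊢
    nlinarith
  have hhalf : ENNReal.ofReal (1 / 2) ≤ μ.tilted (t * S ·) B := by
    have h1 := prob_add_prob_compl (μ := μ.tilted (t * S ·)) hBm
    have h2 : (1 : ENNReal) = ENNReal.ofReal (1 / 2) + ENNReal.ofReal (1 / 2) := by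
      rw [← ENNReal.ofReal_add (by norm_num) (by norm_num)]; norm_num
    rw [h2] at h1
    by_contra! hlt
    exact absurd h1 (ENNReal.add_lt_add_of_lt_of_le (measure_ne_top _ _) hlt hcompl).ne
  have htilt : μ.tilted (t * S ·) B ≤
      ENNReal.ofReal (Real.exp (N * (powerFun γ x + ε))) * μ B := by
    rw [tilted_mul_apply_cgf' hBm hexpint, ← setLIntegral_const]
    refine setLIntegral_mono measurable_const fun ω hω => ENNReal.ofReal_le_ofReal ?_
    rw [Real.exp_le_exp, cgf_sum_weights hW hlaw hind s htD]
    have hle : t * x - cgf id ν t ≤ powerFun γ x := by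
      have := ofReal_le_rate htD x
      rw [rate_of_pos hγ hx] at this
      exact (ENNReal.ofReal_le_ofReal_iff (powerFun_nonneg hγ hx)).1 this
    have h1 : t * (S ω - N * x) ≤ |t| * (N * δ') :=
      (le_abs_self _).trans (by
        rw [abs_mul]; exact mul_le_mul_of_nonneg_left (le_of_lt hω) (abs_nonneg t))
    have h2 : N * (|t| * δ') ≤ N * ε := mul_le_mul_of_nonneg_left htδ hN0.le
    have h3 := mul_le_mul_of_nonneg_left hle hN0.le
    change t * S ω - N * cgf id ν t ≤ _
    nlinarith
  have hfin : ENNReal.ofReal (1 / 2 * Real.exp (-(N * (powerFun γ x + ε)))) ≤ μ B := by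
    rw [ENNReal.ofReal_mul (by norm_num)]
    calc _ ≤ ENNReal.ofReal (Real.exp (N * (powerFun γ x + ε))) * μ B *
          ENNReal.ofReal (Real.exp (-(N * (powerFun γ x + ε)))) := by
          gcongr; exact hhalf.trans htilt
      _ = μ B := by
          rw [mul_right_comm, ← ENNReal.ofReal_mul (Real.exp_pos _).le, ← Real.exp_add,
            add_neg_cancel, Real.exp_zero, ENNReal.ofReal_one, one_mul]
  refine hfin.trans (measure_mono fun ω hω => ?_)
  have h : |S ω - N * x| < N * δ' := hω
  exact h.trans_le (mul_le_mul_of_nonneg_left (min_le_left _ _) hN0.le)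

/-! ### Exponential tails -/

/-- By inner regularity it suffices to treat compact subsets, and such a set lies in the half-line
from its least element, which belongs to `D`. No infimum of `D` has to be attained. -/
lemma measure_le_of_forall_Ici {ρ : Measure ℝ} [IsFiniteMeasure ρ] {D : Set ℝ}
    (hD : MeasurableSet D) {c : ENNReal} (h : ∀ x ∈ D, ρ (Set.Ici x) ≤ c) : ρ D ≤ c := by
  rw [hD.measure_eq_iSup_isCompact]
  refine iSup₂_le fun K hK => iSup_le fun hKc => ?_
  rcases K.eq_empty_or_nonempty with rfl | hne
  · simp
  obtain ⟨x, hxK, hx⟩ := hKc.exists_isLeast hne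
  exact (measure_mono fun y hy => hx hy).trans (h x (hK hxK))

lemma measure_le_of_forall_Iic {ρ : Measure ℝ} [IsFiniteMeasure ρ] {D : Set ℝ}
    (hD : MeasurableSet D) {c : ENNReal} (h : ∀ x ∈ D, ρ (Set.Iic x) ≤ c) : ρ D ≤ c := by
  rw [hD.measure_eq_iSup_isCompact]
  refine iSup₂_le fun K hK => iSup_le fun hKc => ?_
  rcases K.eq_empty_or_nonempty with rfl | hne
  · simp
  obtain ⟨x, hxK, hx⟩ := hKc.exists_isGreatest hne
  exact (measure_mono fun y hy => hx hy).trans (h x (hK hxK))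

/-- The rate function of a block mean has exponential tails. -/
lemma measure_lt_rate_mean_le [IsProbabilityMeasure ν] {γ : ℝ} (hγ : IsPowerWeight ν γ)
    {W : ℕ → Ω → ℝ} (hW : ∀ i, Measurable (W i)) (hlaw : ∀ i, μ.map (W i) = ν)
    (hind : iIndepFun W μ) (s : Finset ℕ) (hs : s.Nonempty) {u : ℝ} (hu : 0 ≤ u) :
    μ {ω | ENNReal.ofReal u < rate ν ((∑ i ∈ s, W i ω) / s.card)} ≤
      2 * ENNReal.ofReal (Real.exp (-(s.card * u))) := by
  have : IsProbabilityMeasure μ := hind.isProbabilityMeasure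
  have hN0 : (0 : ℝ) < s.card := by exact_mod_cast hs.card_pos
  set N : ℝ := (s.card : ℝ) with hN
  set S : Ω → ℝ := fun ω => ∑ i ∈ s, W i ω with hS
  have hSm : Measurable S := Finset.measurable_sum _ fun i _ => hW i
  have hmm : Measurable fun ω => S ω / N := by fun_prop
  set ρ := μ.map fun ω => S ω / N with hρ
  have : IsProbabilityMeasure ρ := Measure.isProbabilityMeasure_map hmm.aemeasurable
  set D : Set ℝ := {x | ENNReal.ofReal u < rate ν x} with hD
  have hDm : MeasurableSet D := (lowerSemicontinuous_rate.isOpen_preimage _).measurableSet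
  -- Since the rate vanishes at `1`, a slope with positive value at `x` has the sign of `x - 1`,
  -- which selects the one-sided Chernoff bound.
  have h1 : ∀ t ∈ integrableExpSet id ν, t - cgf id ν t ≤ 0 := fun t ht => by
    have := ofReal_le_rate ht 1
    rwa [rate_one hγ, mul_one, nonpos_iff_eq_zero, ENNReal.ofReal_eq_zero] at this
  have hup : ρ (D ∩ Set.Ici 1) ≤ ENNReal.ofReal (Real.exp (-(N * u))) := by
    refine measure_le_of_forall_Ici (hDm.inter measurableSet_Ici) fun x ⟨hx, hx1⟩ => ?_
    obtain ⟨t, ht, htx⟩ := exists_lt_of_lt_rate hu hx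
    have ht0 : 0 ≤ t := by
      by_contra! h
      have hx1 : 1 ≤ x := hx1
      nlinarith [h1 t ht]
    rw [hρ, Measure.map_apply hmm measurableSet_Ici, ← ofReal_measureReal]
    refine ENNReal.ofReal_le_ofReal ?_
    have hset : (fun ω => S ω / N) ⁻¹' Set.Ici x = {ω | N * x ≤ S ω} := by
      ext ω
      simp only [Set.mem_preimage, Set.mem_Ici, Set.mem_ofPred_eq]
      rw [le_div_iff₀ hN0, mul_comm]
    rw [hset]
    refine (measure_ge_le_exp_cgf (N * x) ht0 (integrable_exp_sum hW hlaw hind s ht)).trans ?_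
    rw [Real.exp_le_exp, cgf_sum_weights hW hlaw hind s ht]
    nlinarith
  have hlo : ρ (D ∩ Set.Iic 1) ≤ ENNReal.ofReal (Real.exp (-(N * u))) := by
    refine measure_le_of_forall_Iic (hDm.inter measurableSet_Iic) fun x ⟨hx, hx1⟩ => ?_
    obtain ⟨t, ht, htx⟩ := exists_lt_of_lt_rate hu hx
    have ht0 : t ≤ 0 := by
      by_contra! h
      have hx1 : x ≤ 1 := hx1
      nlinarith [h1 t ht]
    rw [hρ, Measure.map_apply hmm measurableSet_Iic, ← ofReal_measureReal]
    refine ENNReal.ofReal_le_ofReal ?_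
    have hset : (fun ω => S ω / N) ⁻¹' Set.Iic x = {ω | S ω ≤ N * x} := by
      ext ω
      simp only [Set.mem_preimage, Set.mem_Iic, Set.mem_ofPred_eq]
      rw [div_le_iff₀ hN0, mul_comm]
    rw [hset]
    refine (measure_le_le_exp_cgf (N * x) ht0 (integrable_exp_sum hW hlaw hind s ht)).trans ?_
    rw [Real.exp_le_exp, cgf_sum_weights hW hlaw hind s ht]
    nlinarith
  calc μ {ω | ENNReal.ofReal u < rate ν (S ω / N)} = ρ D := by
        rw [hρ, Measure.map_apply hmm hDm]; rfl
    _ ≤ ρ ((D ∩ Set.Ici 1) ∪ (D ∩ Set.Iic 1)) := measure_mono fun x hx =>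
        (le_total 1 x).imp (fun h => ⟨hx, h⟩) fun h => ⟨hx, h⟩
    _ ≤ _ := (measure_union_le _ _).trans (by rw [two_mul]; exact add_le_add hup hlo)

/-- A step function dominating `u ↦ exp (l u)` on `[0, ∞]`. -/
def stepExp (l : ℝ) (u : ENNReal) : ENNReal :=
  1 + ∑' j : ℕ, Set.indicator (Set.Ioi (j : ENNReal))
    (fun _ => ENNReal.ofReal (Real.exp (l * (j + 1)))) u

lemma measurable_stepExp (l : ℝ) : Measurable (stepExp l) := by
  have h : ∀ j : ℕ, Measurable (Set.indicator (Set.Ioi (j : ENNReal))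
      fun _ => ENNReal.ofReal (Real.exp (l * (j + 1)))) := fun j =>
    measurable_const.indicator measurableSet_Ioi
  exact measurable_const.add (Measurable.tsum h)

lemma one_le_stepExp (l : ℝ) (u : ENNReal) : 1 ≤ stepExp l u := le_self_add

lemma exp_le_stepExp {l : ℝ} (hl : 0 ≤ l) {v : ℝ} {u : ENNReal} (h : ENNReal.ofReal v ≤ u) :
    ENNReal.ofReal (Real.exp (l * v)) ≤ stepExp l u := by
  rcases le_or_gt v 0 with hv | hv
  · refine le_trans ?_ (one_le_stepExp l u)
    rw [ENNReal.ofReal_le_one, Real.exp_le_one_iff]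
    exact mul_nonpos_of_nonneg_of_nonpos hl hv
  -- The layer with `j < v ≤ j + 1`: the strict inequality activates its indicator and the other one
  -- gives the size.
  · set j := ⌈v⌉₊ - 1 with hj
    have hc : 0 < ⌈v⌉₊ := Nat.ceil_pos.2 hv
    have hj1 : v ≤ j + 1 := by
      have : ((j + 1 : ℕ) : ℝ) = ⌈v⌉₊ := by rw [hj]; congr 1; omega
      push_cast at this
      rw [this]
      exact Nat.le_ceil v
    have hj2 : (j : ℝ) < v := Nat.lt_ceil.1 (by omega)
    have hju : (j : ENNReal) < u := by
      refine lt_of_lt_of_le ?_ h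
      rw [← ENNReal.ofReal_natCast]
      exact (ENNReal.ofReal_lt_ofReal_iff hv).2 hj2
    refine le_trans ?_ le_add_self
    refine le_trans ?_ (ENNReal.le_tsum j)
    rw [Set.indicator_of_mem (Set.mem_Ioi.2 hju)]
    exact ENNReal.ofReal_le_ofReal (Real.exp_le_exp.2 (mul_le_mul_of_nonneg_left hj1 hl))

/-- Turns a bound on a sum into one on a product of functions of single blocks, to which
independence applies. An infinite summand is handled by its own factor, the other factors being at
least `1`. -/
lemma exp_le_prod_stepExp {ι : Type*} {l : ℝ} (hl : 0 ≤ l) (s : Finset ι) (c : ι → ENNReal) (a : ℝ)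
    (h : ENNReal.ofReal a ≤ ∑ k ∈ s, c k) :
    ENNReal.ofReal (Real.exp (l * a)) ≤ ∏ k ∈ s, stepExp l (c k) := by
  classical
  induction s using Finset.induction_on generalizing a with
  | empty =>
    rw [Finset.sum_empty, nonpos_iff_eq_zero, ENNReal.ofReal_eq_zero] at h
    rw [Finset.prod_empty, ENNReal.ofReal_le_one, Real.exp_le_one_iff]
    exact mul_nonpos_of_nonneg_of_nonpos hl h
  | insert k s hk ih =>
    rw [Finset.sum_insert hk] at h
    rw [Finset.prod_insert hk]
    by_cases hc : c k = ⊤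
    · have h1 : ENNReal.ofReal a ≤ c k := by rw [hc]; exact le_top
      calc _ ≤ stepExp l (c k) := exp_le_stepExp hl h1
        _ ≤ _ := le_mul_of_one_le_right' (Finset.one_le_prod' fun i _ => one_le_stepExp l _)
    · have h1 : ENNReal.ofReal (a - (c k).toReal) ≤ ∑ i ∈ s, c i := by
        rw [ENNReal.ofReal_sub _ ENNReal.toReal_nonneg, ENNReal.ofReal_toReal hc]
        exact tsub_le_iff_left.2 h
      have h2 := ih _ h1
      have h3 : ENNReal.ofReal (Real.exp (l * (c k).toReal)) ≤ stepExp l (c k) :=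
        exp_le_stepExp hl (ENNReal.ofReal_toReal hc).le
      refine le_trans (le_of_eq ?_) (mul_le_mul' h3 h2)
      rw [← ENNReal.ofReal_mul (Real.exp_pos _).le, ← Real.exp_add]
      congr 2
      ring

/-- A bound for the expectation of `stepExp` of a block. -/
def stepExpBound (l : ℝ) : ENNReal :=
  1 + ∑' j : ℕ, ENNReal.ofReal (2 * Real.exp l * Real.exp (-(1 - l)) ^ j)

lemma stepExpBound_ne_top {l : ℝ} (hl : l < 1) : stepExpBound l ≠ ⊤ := by
  refine ENNReal.add_ne_top.2 ⟨ENNReal.one_ne_top, ?_⟩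
  have hs : Summable fun j : ℕ => 2 * Real.exp l * Real.exp (-(1 - l)) ^ j :=
    (summable_geometric_of_lt_one (Real.exp_pos _).le
      (Real.exp_lt_one_iff.2 (by linarith))).mul_left _
  exact hs.tsum_ofReal_ne_top

/-- The scaled rate of a block exceeds `j` with probability at most `2 e^{-j}`, so the layers are
dominated by a geometric series of ratio `e^{-(1 - l)}`, whatever the block size. -/
lemma lintegral_stepExp_le [IsProbabilityMeasure ν] {γ : ℝ} (hγ : IsPowerWeight ν γ)
    {W : ℕ → Ω → ℝ} (hW : ∀ i, Measurable (W i)) (hlaw : ∀ i, μ.map (W i) = ν)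
    (hind : iIndepFun W μ) (s : Finset ℕ) (l : ℝ) :
    ∫⁻ ω, stepExp l (s.card * rate ν ((∑ i ∈ s, W i ω) / s.card)) ∂μ ≤ stepExpBound l := by
  have : IsProbabilityMeasure μ := hind.isProbabilityMeasure
  set c : Ω → ENNReal := fun ω => s.card * rate ν ((∑ i ∈ s, W i ω) / s.card) with hc
  have hcm : Measurable c := by
    have h1 : Measurable (rate ν) := lowerSemicontinuous_rate.measurable
    have h2 : Measurable fun ω => (∑ i ∈ s, W i ω) / (s.card : ℝ) :=
      (Finset.measurable_sum _ fun i _ => hW i).div_const _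
    exact (h1.comp h2).const_mul _
  have hset : ∀ j : ℕ, MeasurableSet (c ⁻¹' Set.Ioi (j : ENNReal)) := fun j => hcm measurableSet_Ioi
  change ∫⁻ ω, (1 + ∑' j : ℕ, Set.indicator (c ⁻¹' Set.Ioi (j : ENNReal))
      (fun _ => ENNReal.ofReal (Real.exp (l * (j + 1)))) ω) ∂μ ≤ _
  rw [lintegral_add_left measurable_const, lintegral_tsum fun j =>
    (measurable_const.indicator (hset j)).aemeasurable]
  rw [lintegral_const, measure_univ, mul_one, stepExpBound]
  refine add_le_add le_rfl (ENNReal.tsum_le_tsum fun j => ?_)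
  rw [lintegral_indicator_const (hset j)]
  have hb : μ (c ⁻¹' Set.Ioi (j : ENNReal)) ≤ 2 * ENNReal.ofReal (Real.exp (-(j : ℝ))) := by
    rcases s.eq_empty_or_nonempty with rfl | hs
    · simp [hc]
    · have hN0 : (0 : ℝ) < s.card := by exact_mod_cast hs.card_pos
      have hsub : c ⁻¹' Set.Ioi (j : ENNReal) ⊆
          {ω | ENNReal.ofReal (j / s.card) < rate ν ((∑ i ∈ s, W i ω) / s.card)} := fun ω hω => by
        have hω : (j : ENNReal) < s.card * rate ν ((∑ i ∈ s, W i ω) / s.card) := hω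
        simp only [Set.mem_ofPred_eq]
        rw [ENNReal.ofReal_div_of_pos hN0, ENNReal.ofReal_natCast, ENNReal.ofReal_natCast]
        exact ENNReal.div_lt_of_lt_mul' hω
      refine (measure_mono hsub).trans
        ((measure_lt_rate_mean_le hγ hW hlaw hind s hs (by positivity)).trans ?_)
      rw [mul_div_cancel₀ _ hN0.ne']
  calc _ ≤ ENNReal.ofReal (Real.exp (l * (j + 1))) * (2 * ENNReal.ofReal (Real.exp (-(j : ℝ)))) := by
        gcongr
    _ = _ := by
      rw [show (2 : ENNReal) = ENNReal.ofReal 2 by simp, ← ENNReal.ofReal_mul (by norm_num),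
        ← ENNReal.ofReal_mul (Real.exp_pos _).le, ← Real.exp_nat_mul]
      congr 1
      rw [mul_left_comm, mul_assoc, ← Real.exp_add, ← Real.exp_add]
      congr 2
      ring

/-- **Chernoff bound** for the rate functional of the vector of block means. -/
lemma measure_le_sum_rate_le [IsProbabilityMeasure ν] {γ : ℝ} (hγ : IsPowerWeight ν γ)
    {W : ℕ → Ω → ℝ} (hW : ∀ i, Measurable (W i)) (hlaw : ∀ i, μ.map (W i) = ν)
    (hind : iIndepFun W μ) {κ : Type*} [Fintype κ] (s : κ → Finset ℕ)
    (hs : Pairwise fun j k => Disjoint (s j) (s k)) {l : ℝ} (hl : 0 ≤ l) (a : ℝ) :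
    μ {ω | ENNReal.ofReal a ≤
        ∑ k, (s k).card * rate ν ((∑ i ∈ s k, W i ω) / (s k).card)} ≤
      ENNReal.ofReal (Real.exp (-(l * a))) * stepExpBound l ^ Fintype.card κ := by
  have : IsProbabilityMeasure μ := hind.isProbabilityMeasure
  set c : κ → Ω → ENNReal :=
    fun k ω => (s k).card * rate ν ((∑ i ∈ s k, W i ω) / (s k).card) with hc
  have hrm : Measurable (rate ν) := lowerSemicontinuous_rate.measurable
  have hg : ∀ k, Measurable fun y : ℝ =>
      stepExp l (((s k).card : ENNReal) * rate ν (y / (s k).card)) := fun k =>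
    (measurable_stepExp l).comp ((hrm.comp (measurable_id.div_const _)).const_mul _)
  have hSm : ∀ k, Measurable fun ω => ∑ i ∈ s k, W i ω := fun k =>
    Finset.measurable_sum _ fun i _ => hW i
  have hI : iIndepFun (fun k ω => stepExp l (c k ω)) μ :=
    (iIndepFun_block_sums hW hind s hs).comp _ hg
  have hm : ∀ k, Measurable fun ω => stepExp l (c k ω) := fun k => (hg k).comp (hSm k)
  have hint : ∫⁻ ω, ∏ k, stepExp l (c k ω) ∂μ ≤ stepExpBound l ^ Fintype.card κ := by
    rw [lintegral_prod_eq_prod_lintegral_of_indepFun _ _ hI hm]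
    refine (Finset.prod_le_prod' fun k _ => lintegral_stepExp_le hγ hW hlaw hind (s k) l).trans ?_
    simp
  have hmk := mul_meas_ge_le_lintegral₀ (μ := μ)
    (Finset.measurable_prod Finset.univ fun k _ => hm k).aemeasurable
    (ENNReal.ofReal (Real.exp (l * a)))
  have hsub : {ω | ENNReal.ofReal a ≤ ∑ k, c k ω} ⊆
      {ω | ENNReal.ofReal (Real.exp (l * a)) ≤ ∏ k, stepExp l (c k ω)} := fun ω hω =>
    exp_le_prod_stepExp hl _ _ a hω
  calc _ ≤ μ {ω | ENNReal.ofReal (Real.exp (l * a)) ≤ ∏ k, stepExp l (c k ω)} := measure_mono hsub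
    _ = ENNReal.ofReal (Real.exp (-(l * a))) * (ENNReal.ofReal (Real.exp (l * a)) *
          μ {ω | ENNReal.ofReal (Real.exp (l * a)) ≤ ∏ k, stepExp l (c k ω)}) := by
        rw [← mul_assoc, ← ENNReal.ofReal_mul (Real.exp_pos _).le, ← Real.exp_add,
          neg_add_cancel, Real.exp_zero, ENNReal.ofReal_one, one_mul]
    _ ≤ _ := by
        gcongr
        exact hmk.trans hint

end

section

variable {ν : Measure ℝ} {Ω : Type*} [MeasurableSpace Ω] {μ : Measure Ω}
variable {Y : Type*}

/-! ### Bootstrapped measures of a fixed sequence of observations -/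

open Classical in
/-- The indices `i < n` of the observations equal to `k`. -/
def block (n : ℕ) (x : ℕ → Y) (k : Y) : Finset ℕ := (Finset.range n).filter fun i => x i = k

lemma empirical_eq (n : ℕ) (x : ℕ → Y) (k : Y) :
    empirical n x k = ((block n x k).card : ℝ) / n := rfl

lemma pairwise_disjoint_block (n : ℕ) (x : ℕ → Y) :
    Pairwise fun j k => Disjoint (block n x j) (block n x k) := fun j k hjk => by
  refine Finset.disjoint_left.2 fun i hi hi' => hjk ?_
  simp only [block, Finset.mem_filter] at hi hi'
  exact hi.2.symm.trans hi'.2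

lemma bootMeasure_eq_some {n : ℕ} {x : ℕ → Y} {w : ℕ → ℝ} (h : ∑ j ∈ Finset.range n, w j ≠ 0) :
    bootMeasure n x w =
      some fun k => (∑ i ∈ block n x k, w i) / ∑ j ∈ Finset.range n, w j := by
  rw [bootMeasure, if_neg h]
  simp only [Finset.sum_div]
  rfl

lemma bootMeasure_eq_none {n : ℕ} {x : ℕ → Y} {w : ℕ → ℝ} (h : ∑ j ∈ Finset.range n, w j = 0) :
    bootMeasure n x w = none := if_pos h

lemma tendsto_card_block {p : Y → ℝ} {x : ℕ → Y} {k : Y} (hpos : 0 < p k)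
    (hx : Tendsto (fun n => empirical n x k) atTop (𝓝 (p k))) :
    Tendsto (fun n => (block n x k).card) atTop atTop := by
  rw [← tendsto_natCast_atTop_iff (R := ℝ)]
  refine (hx.pos_mul_atTop hpos tendsto_natCast_atTop_atTop).congr' ?_
  filter_upwards [eventually_ne_atTop 0] with n hn
  rw [empirical_eq, div_mul_cancel₀ _ (Nat.cast_ne_zero.2 hn)]

variable [Fintype Y]

lemma sum_sum_block {M : Type*} [AddCommMonoid M] (n : ℕ) (x : ℕ → Y) (f : ℕ → M) :
    ∑ k, ∑ i ∈ block n x k, f i = ∑ i ∈ Finset.range n, f i := by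
  classical
  rw [← Finset.sum_fiberwise (Finset.range n) x f]
  refine Finset.sum_congr rfl fun k _ => Finset.sum_congr ?_ fun _ _ => rfl
  ext i
  simp [block]

lemma empirical_mem_stdSimplex {n : ℕ} (hn : n ≠ 0) (x : ℕ → Y) :
    empirical n x ∈ stdSimplex ℝ Y := by
  refine ⟨fun k => by rw [empirical_eq]; positivity, ?_⟩
  have h := sum_sum_block n x fun _ => (1 : ℝ)
  simp only [Finset.sum_const, nsmul_eq_mul, mul_one, Finset.card_range] at h
  simp_rw [empirical_eq, ← Finset.sum_div, h]
  exact div_self (Nat.cast_ne_zero.2 hn)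

/-- If the divergence of the block means relative to the empirical weights is small, so is the
divergence statistic. -/
lemma eventually_divStat_le [IsProbabilityMeasure ν] {γ : ℝ} (hγ : IsPowerWeight ν γ)
    {p : Y → ℝ} (hp : p ∈ stdSimplex ℝ Y) (hpos : ∀ k, 0 < p k) {x : ℕ → Y}
    (hx : ∀ k, Tendsto (fun n => empirical n x k) atTop (𝓝 (p k))) {a s : ℝ} (hs : 0 ≤ s)
    (hsa : s < a) (ha : ENNReal.ofReal a ≤ rate ν 0) :
    ∀ᶠ n in atTop, ∀ w : ℕ → ℝ, ∑ k, ENNReal.ofReal (empirical n x k) *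
        rate ν ((∑ i ∈ block n x k, w i) / (block n x k).card) < ENNReal.ofReal s →
      divStat ν p (bootMeasure n x w) ≤ a := by
  -- The solution of `(1 + ε) s + ε = a`: the factor pays for replacing empirical weights by `p`,
  -- the summand for shrinking the arguments.
  set ε := (a - s) / (s + 1) with hε
  have hs1 : 0 < s + 1 := by linarith
  have hε0 : 0 < ε := div_pos (sub_pos.2 hsa) hs1
  have hεa : (1 + ε) * s + ε = a := by
    rw [hε]; field_simp; ring
  -- Once the empirical masses exceed `p k / 2`, this bounds the rate of every block mean.
  set C := ∑ k, 2 * s / p k with hC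
  obtain ⟨δ, hδ0, hδ1, hδ⟩ := exists_rate_mul_le hγ C hε0
  -- Midway in the allowed range, so that `c` times the ratio of empirical to true mass eventually
  -- lies strictly between `1 - δ` and `1`.
  set c := 1 - δ / 2 with hc
  have hc0 : 0 < c := by linarith
  have e1 : ∀ᶠ n in atTop, ∀ k, 1 - δ < c * empirical n x k / p k := by
    rw [eventually_all]
    intro k
    have h : Tendsto (fun n => c * empirical n x k / p k) atTop (𝓝 (c * p k / p k)) :=
      ((hx k).const_mul c).div_const _
    rw [mul_div_cancel_right₀ _ (hpos k).ne'] at h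
    exact h.eventually (lt_mem_nhds (by linarith))
  have e2 : ∀ᶠ n in atTop, ∀ k, c * empirical n x k / p k < 1 := by
    rw [eventually_all]
    intro k
    have h : Tendsto (fun n => c * empirical n x k / p k) atTop (𝓝 (c * p k / p k)) :=
      ((hx k).const_mul c).div_const _
    rw [mul_div_cancel_right₀ _ (hpos k).ne'] at h
    exact h.eventually (gt_mem_nhds (by linarith))
  have e3 : ∀ᶠ n in atTop, ∀ k, p k < (1 + ε) * empirical n x k := by
    rw [eventually_all]
    intro k
    refine ((hx k).const_mul (1 + ε)).eventually (lt_mem_nhds ?_)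
    nlinarith [hpos k]
  have e4 : ∀ᶠ n in atTop, ∀ k, p k / 2 < empirical n x k := by
    rw [eventually_all]
    exact fun k => (hx k).eventually (lt_mem_nhds (half_lt_self (hpos k)))
  filter_upwards [e1, e2, e3, e4, eventually_ne_atTop 0] with n h1 h2 h3 h4 hn w hw
  have hn0 : (n : ℝ) ≠ 0 := Nat.cast_ne_zero.2 hn
  have hemp0 : ∀ k, 0 < empirical n x k := fun k => (half_pos (hpos k)).trans (h4 k)
  have hcard : ∀ k, ((block n x k).card : ℝ) ≠ 0 := fun k h => by
    have := hemp0 k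
    rw [empirical_eq, h, zero_div] at this
    exact lt_irrefl _ this
  set z : Y → ℝ := fun k => (∑ i ∈ block n x k, w i) / (block n x k).card with hz
  have hempz : ∀ k, empirical n x k * z k = (∑ i ∈ block n x k, w i) / n := fun k => by
    have := hcard k
    simp only [hz, empirical_eq]
    field_simp
  by_cases hsum : ∑ j ∈ Finset.range n, w j = 0
  -- Weights summing to `0` have overall mean `0`, so by Jensen's inequality the block divergence
  -- would be at least `φ^W(0)`, hence at least `a`.
  · exfalso
    have hJ := rate_sum_le (ν := ν) (empirical_mem_stdSimplex hn x) z
    simp_rw [hempz] at hJ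
    rw [← Finset.sum_div, sum_sum_block, hsum, zero_div] at hJ
    exact absurd (hJ.trans_lt hw)
      (not_lt.2 ((ENNReal.ofReal_le_ofReal hsa.le).trans ha))
  · rw [bootMeasure_eq_some hsum]
    -- This multiple undoes the normalization: the ratios to `p` become the block means times
    -- factors just below `1`.
    have hm : c * (∑ j ∈ Finset.range n, w j) / n ≠ 0 :=
      div_ne_zero (mul_ne_zero hc0.ne' hsum) hn0
    refine (scaledDiv_le hp.1 _ hm).trans ?_
    have ha0 : 0 ≤ a := hs.trans hsa.le
    rw [show (a : EReal) = ((ENNReal.ofReal a : ENNReal) : EReal) by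
      rw [EReal.coe_ennreal_ofReal, max_eq_left ha0], EReal.coe_ennreal_le_coe_ennreal_iff]
    have hzC : ∀ k, rate ν (z k) ≤ ENNReal.ofReal C := fun k => by
      have hk : ENNReal.ofReal (empirical n x k) * rate ν (z k) ≤ ENNReal.ofReal s :=
        (Finset.single_le_sum (f := fun k => ENNReal.ofReal (empirical n x k) * rate ν (z k))
          (fun _ _ => zero_le) (Finset.mem_univ k)).trans hw.le
      have hk' : rate ν (z k) ≤ ENNReal.ofReal (s / empirical n x k) := by
        rw [ENNReal.ofReal_div_of_pos (hemp0 k), ENNReal.le_div_iff_mul_le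
          (Or.inl (by simpa using hemp0 k)) (Or.inl ENNReal.ofReal_ne_top), mul_comm]
        exact hk
      refine hk'.trans (ENNReal.ofReal_le_ofReal ?_)
      have h5 : 2 * s / p k ≤ C := Finset.single_le_sum (f := fun k => 2 * s / p k)
        (fun i _ => div_nonneg (by linarith) (hpos i).le) (Finset.mem_univ k)
      refine le_trans ?_ h5
      rw [div_le_div_iff₀ (hemp0 k) (hpos k)]
      nlinarith [h4 k]
    calc rateDiv ν _ p ≤ ∑ k, ENNReal.ofReal (p k) * (rate ν (z k) + ENNReal.ofReal ε) := by
          refine Finset.sum_le_sum fun k _ => ?_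
          gcongr
          have harg : ((c * (∑ j ∈ Finset.range n, w j) / n) • fun k =>
              (∑ i ∈ block n x k, w i) / ∑ j ∈ Finset.range n, w j) k / p k =
              (c * empirical n x k / p k) * z k := by
            have := (hpos k).ne'
            have h6 : (c * empirical n x k / p k) * z k = c * (empirical n x k * z k) / p k := by
              ring
            rw [h6, hempz k, Pi.smul_apply, smul_eq_mul]
            field_simp
          rw [harg]
          exact hδ _ (hzC k) _ (h1 k).le (h2 k).le
      _ = ∑ k, ENNReal.ofReal (p k) * rate ν (z k) + ENNReal.ofReal ε := by
          simp_rw [mul_add, Finset.sum_add_distrib, ← Finset.sum_mul]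
          rw [sum_ofReal_eq_one hp, one_mul]
      _ ≤ ENNReal.ofReal (1 + ε) * ENNReal.ofReal s + ENNReal.ofReal ε := by
          gcongr
          refine le_trans ?_ (mul_le_mul_right hw.le _)
          rw [Finset.mul_sum]
          refine Finset.sum_le_sum fun k _ => ?_
          rw [← mul_assoc, ← ENNReal.ofReal_mul (by positivity)]
          gcongr
          exact (h3 k).le
      _ = ENNReal.ofReal a := by
          rw [← ENNReal.ofReal_mul (by positivity), ← ENNReal.ofReal_add (by positivity) hε0.le, hεa]

lemma eventually_le_exp_mul {c : ℝ} (hc : 0 < c) (K : ℝ) :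
    ∀ᶠ n : ℕ in atTop, K ≤ Real.exp (n * c) :=
  (Real.tendsto_exp_atTop.comp
    (tendsto_natCast_atTop_atTop.atTop_mul_const hc)).eventually_ge_atTop K

/-- Large deviation upper bound for the divergence statistic of the bootstrapped measure. -/
lemma eventually_measure_lt_divStat_le [IsProbabilityMeasure ν] {γ : ℝ} (hγ : IsPowerWeight ν γ)
    {W : ℕ → Ω → ℝ} (hW : ∀ i, Measurable (W i)) (hlaw : ∀ i, μ.map (W i) = ν)
    (hind : iIndepFun W μ) {p : Y → ℝ} (hp : p ∈ stdSimplex ℝ Y) (hpos : ∀ k, 0 < p k)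
    {x : ℕ → Y} (hx : ∀ k, Tendsto (fun n => empirical n x k) atTop (𝓝 (p k))) {a b : ℝ}
    (hb : 0 ≤ b) (hba : b < a) (ha : ENNReal.ofReal a ≤ rate ν 0) :
    ∀ᶠ n : ℕ in atTop, ∃ B : Set (ℕ → ℝ), MeasurableSet B ∧
      (∀ w, (a : EReal) < divStat ν p (bootMeasure n x w) → w ∈ B) ∧
      μ {ω | (fun i => W i ω) ∈ B} ≤ ENNReal.ofReal (Real.exp (-(n * b))) := by
  set s := (a + b) / 2 with hs
  have hs0 : 0 < s := by linarith
  -- Chosen with `l < 1` and `l s > b`; the gap `l s - b` absorbs the constant `K` for large `n`.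
  set l := (b + s) / (2 * s) with hl
  have hl0 : 0 ≤ l := by positivity
  have hl1 : l < 1 := by
    rw [hl, div_lt_one (by positivity)]
    linarith
  have hls : l * s = (b + s) / 2 := by rw [hl]; field_simp
  have hgap : 0 < l * s - b := by rw [hls]; linarith
  set K := stepExpBound l ^ Fintype.card Y with hK
  have hKtop : K ≠ ⊤ := ENNReal.pow_ne_top (stepExpBound_ne_top hl1)
  filter_upwards [eventually_divStat_le hγ hp hpos hx hs0.le (show s < a by linarith) ha,
    eventually_le_exp_mul hgap K.toReal, eventually_ne_atTop 0] with n h1 h2 hn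
  have hn0 : (0 : ℝ) < n := by positivity
  -- A measurable event containing the exceedance event, which avoids any measurability question
  -- about the statistic itself.
  refine ⟨{w | ENNReal.ofReal (n * s) ≤ ∑ k, ((block n x k).card : ENNReal) *
    rate ν ((∑ i ∈ block n x k, w i) / (block n x k).card)}, ?_, ?_, ?_⟩
  · refine measurableSet_le measurable_const (Finset.measurable_sum _ fun k _ => ?_)
    exact ((lowerSemicontinuous_rate (ν := ν)).measurable.comp ((Finset.measurable_sum _ fun i _ =>
      measurable_pi_apply i).div_const _)).const_mul _
  · intro w hw
    by_contra hlt
    refine absurd (h1 w ?_) (not_le.2 hw)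
    rw [Set.mem_ofPred_eq, not_le, ENNReal.ofReal_mul hn0.le] at hlt
    have hcard : ∀ k, ((block n x k).card : ENNReal) =
        ENNReal.ofReal n * ENNReal.ofReal (empirical n x k) := fun k => by
      rw [← ENNReal.ofReal_mul hn0.le, empirical_eq, mul_div_cancel₀ _ hn0.ne',
        ENNReal.ofReal_natCast]
    simp_rw [hcard, mul_assoc, ← Finset.mul_sum] at hlt
    exact lt_of_mul_lt_mul_left' hlt
  · refine (measure_le_sum_rate_le hγ hW hlaw hind (block n x) (pairwise_disjoint_block n x) hl0
      (n * s)).trans ?_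
    rw [← hK, ← ENNReal.ofReal_toReal hKtop, ← ENNReal.ofReal_mul (Real.exp_pos _).le]
    apply ENNReal.ofReal_le_ofReal
    calc _ ≤ Real.exp (-(l * (n * s))) * Real.exp (n * (l * s - b)) := by gcongr
      _ = _ := by rw [← Real.exp_add]; congr 1; ring

/-- If the block means are close to `y` and the empirical weights close to `p`, the bootstrapped
measure is close to the normalization of `p y`. -/
lemma exists_forall_bootMeasure_mem {p y R : Y → ℝ} {m : ℝ} (hm : 0 < m)
    (hy : ∀ k, p k * y k = m * R k) (hR : R ∈ stdSimplex ℝ Y) {U : Set (Y → ℝ)} (hU : U ∈ 𝓝 R)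
    {x : ℕ → Y} (hpos : ∀ k, 0 < p k)
    (hx : ∀ k, Tendsto (fun n => empirical n x k) atTop (𝓝 (p k))) :
    ∃ δ : ℝ, 0 < δ ∧ ∀ᶠ n : ℕ in atTop, ∀ w : ℕ → ℝ,
      (∀ k, |(∑ i ∈ block n x k, w i) / (block n x k).card - y k| < δ) →
      ∃ R' ∈ U, bootMeasure n x w = some R' ∧ ∑ k, R' k = 1 := by
  have hsum : ∑ k, p k * y k = m := by
    simp_rw [hy, ← Finset.mul_sum, hR.2, mul_one]
  set D : (Y → ℝ) × (Y → ℝ) → ℝ := fun v => ∑ k, v.1 k * v.2 k with hD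
  set F : (Y → ℝ) × (Y → ℝ) → Y → ℝ := fun v k => v.1 k * v.2 k / D v with hF
  have hDc : Continuous D := by fun_prop
  have hDm : D (p, y) = m := hsum
  have hFc : ContinuousAt F (p, y) := by
    refine continuousAt_pi.2 fun k => ContinuousAt.div (by fun_prop) hDc.continuousAt ?_
    rw [hDm]; exact hm.ne'
  have hFR : F (p, y) = R := by
    funext k
    simp only [hF]
    rw [hDm, hy, mul_div_cancel_left₀ _ hm.ne']
  have hev : ∀ᶠ v in 𝓝 p ×ˢ 𝓝 y, F v ∈ U ∧ D v ≠ 0 := by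
    rw [← nhds_prod_eq]
    exact (hFc.eventually (by rw [hFR]; exact hU)).and
      (hDc.continuousAt.eventually_ne (by rw [hDm]; exact hm.ne'))
  obtain ⟨pa, ha, pb, hb, hab⟩ := eventually_prod_iff.1 hev
  obtain ⟨δ, hδ, hball⟩ := Metric.eventually_nhds_iff.1 hb
  refine ⟨δ, hδ, ?_⟩
  have hxp : Tendsto (fun n => empirical n x) atTop (𝓝 p) := tendsto_pi_nhds.2 hx
  have hcard : ∀ᶠ n in atTop, ∀ k, 0 < (block n x k).card := by
    rw [eventually_all]
    exact fun k => (tendsto_card_block (hpos k) (hx k)).eventually_gt_atTop 0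
  filter_upwards [hxp.eventually ha, hcard, eventually_ne_atTop 0] with n hpa hc hn w hw
  have hn0 : (n : ℝ) ≠ 0 := Nat.cast_ne_zero.2 hn
  set z : Y → ℝ := fun k => (∑ i ∈ block n x k, w i) / (block n x k).card with hz
  have hzb : pb z := hball ((dist_pi_lt_iff hδ).2 fun k => by rw [Real.dist_eq]; exact hw k)
  obtain ⟨hFU, hD0⟩ := hab hpa hzb
  have hempz : ∀ k, empirical n x k * z k = (∑ i ∈ block n x k, w i) / n := fun k => by
    have : ((block n x k).card : ℝ) ≠ 0 := Nat.cast_ne_zero.2 (hc k).ne'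
    simp only [hz, empirical_eq]
    field_simp
  have hDz : D (empirical n x, z) = (∑ j ∈ Finset.range n, w j) / n := by
    simp only [hD, hempz, ← Finset.sum_div, sum_sum_block]
  have hs0 : ∑ j ∈ Finset.range n, w j ≠ 0 := fun h => hD0 (by rw [hDz, h, zero_div])
  refine ⟨_, hFU, ?_, ?_⟩
  · rw [bootMeasure_eq_some hs0]
    congr 1
    funext k
    simp only [hF]
    rw [hempz, hDz, div_div_div_cancel_right₀ hn0]
  · simp only [hF, ← Finset.sum_div]
    exact div_self hD0

/-- Large deviation lower bound for the bootstrapped measure near a positive point. -/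
lemma eventually_le_measure_bootMeasure_mem [IsProbabilityMeasure ν] {γ : ℝ}
    (hγ : IsPowerWeight ν γ) {W : ℕ → Ω → ℝ} (hW : ∀ i, Measurable (W i))
    (hlaw : ∀ i, μ.map (W i) = ν) (hind : iIndepFun W μ) {p : Y → ℝ}
    (hpos : ∀ k, 0 < p k) {x : ℕ → Y}
    (hx : ∀ k, Tendsto (fun n => empirical n x k) atTop (𝓝 (p k))) {R : Y → ℝ}
    (hR : R ∈ stdSimplex ℝ Y) (hRpos : ∀ k, 0 < R k) {m : ℝ} (hm : 0 < m) {U : Set (Y → ℝ)}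
    (hU : U ∈ 𝓝 R) {b : ℝ} (hb : (rateDiv ν (m • R) p : EReal) < b) :
    ∀ᶠ n : ℕ in atTop, ∃ B : Set (ℕ → ℝ), MeasurableSet B ∧
      (∀ w ∈ B, ∃ R' ∈ U, bootMeasure n x w = some R' ∧ R' ∈ stdSimplex ℝ Y) ∧
      ENNReal.ofReal (Real.exp (-(n * b))) ≤ μ {ω | (fun i => W i ω) ∈ B} := by
  have : IsProbabilityMeasure μ := hind.isProbabilityMeasure
  set y : Y → ℝ := fun k => m * R k / p k with hy
  have hy0 : ∀ k, 0 < y k := fun k => div_pos (mul_pos hm (hRpos k)) (hpos k)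
  have hpy : ∀ k, p k * y k = m * R k := fun k => mul_div_cancel₀ _ (hpos k).ne'
  set D := ∑ k, p k * powerFun γ (y k) with hD
  have hDb : D < b := by
    have h : rateDiv ν (m • R) p = ENNReal.ofReal D := by
      rw [hD, ENNReal.ofReal_sum_of_nonneg
        fun k _ => mul_nonneg (hpos k).le (powerFun_nonneg hγ (hy0 k))]
      refine Finset.sum_congr rfl fun k _ => ?_
      rw [ENNReal.ofReal_mul (hpos k).le, ← rate_of_pos hγ (hy0 k)]
      rfl
    rw [h, EReal.coe_ennreal_ofReal] at hb
    exact (le_max_left _ _).trans_lt (by exact_mod_cast hb)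
  -- One third each for Cramér's slack, for the fluctuation of the empirical weights, and for the
  -- factor `2^{-|Y|}` from the product over the letters.
  set ε := (b - D) / 3 with hε
  have hε0 : 0 < ε := by linarith
  have hU' : U ∩ {R' | ∀ k, 0 < R' k} ∈ 𝓝 R := by
    refine inter_mem hU ?_
    have : ∀ᶠ R' in 𝓝 R, ∀ k, 0 < R' k := by
      rw [eventually_all]
      exact fun k => (continuous_apply k).continuousAt.eventually (lt_mem_nhds (hRpos k))
    exact this
  obtain ⟨δ, hδ, hboot⟩ := exists_forall_bootMeasure_mem hm hpy hR hU' hpos hx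
  choose N₀ hN₀ using fun k => cramer_lower hγ hW hlaw hind (hy0 k) hδ hε0
  have hcard : ∀ᶠ n in atTop, ∀ k, max 1 (N₀ k) ≤ (block n x k).card := by
    rw [eventually_all]
    exact fun k => (tendsto_card_block (hpos k) (hx k)).eventually_ge_atTop _
  have hmean : ∀ᶠ n in atTop, ∑ k, empirical n x k * (powerFun γ (y k) + ε) < D + 2 * ε := by
    have hlim : Tendsto (fun n => ∑ k, empirical n x k * (powerFun γ (y k) + ε)) atTop
        (𝓝 (∑ k, p k * (powerFun γ (y k) + ε))) :=
      tendsto_finsetSum _ fun k _ => (hx k).mul_const _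
    refine hlim.eventually (gt_mem_nhds ?_)
    have hp1 : ∑ k, p k = 1 := by
      refine tendsto_nhds_unique (tendsto_finsetSum Finset.univ fun k _ => hx k)
        (tendsto_const_nhds.congr' ?_)
      filter_upwards [eventually_ne_atTop 0] with n hn
      exact (empirical_mem_stdSimplex hn x).2.symm
    simp_rw [mul_add, Finset.sum_add_distrib, ← Finset.sum_mul, hp1]
    linarith
  filter_upwards [hboot, hcard, hmean, eventually_le_exp_mul hε0 (2 ^ Fintype.card Y),
    eventually_ne_atTop 0] with n h1 h2 h3 h4 hn
  have hn0 : (n : ℝ) ≠ 0 := Nat.cast_ne_zero.2 hn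
  set A : Y → Set ℝ := fun k => {v | |v - (block n x k).card * y k| < (block n x k).card * δ}
    with hA
  have hAm : ∀ k, MeasurableSet (A k) := fun k =>
    measurableSet_lt (by fun_prop) measurable_const
  have hSm : ∀ k, Measurable fun w : ℕ → ℝ => ∑ i ∈ block n x k, w i := fun k =>
    Finset.measurable_sum _ fun i _ => measurable_pi_apply i
  refine ⟨⋂ k ∈ Finset.univ, (fun w : ℕ → ℝ => ∑ i ∈ block n x k, w i) ⁻¹' A k,
    Finset.measurableSet_biInter _ fun k _ => hSm k (hAm k), fun w hw => ?_, ?_⟩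
  · simp only [Set.mem_iInter, Finset.mem_univ, true_implies, Set.mem_preimage] at hw
    obtain ⟨R', ⟨hR'U, hR'0⟩, hR', hR'1⟩ := h1 w fun k => by
      have hc : (0 : ℝ) < (block n x k).card := by
        exact_mod_cast (le_max_left 1 (N₀ k)).trans (h2 k)
      have hk : |∑ i ∈ block n x k, w i - (block n x k).card * y k| <
        (block n x k).card * δ := hw k
      rw [div_sub' hc.ne', abs_div, abs_of_pos hc, div_lt_iff₀ hc, mul_comm δ]
      exact hk
    exact ⟨R', hR'U, hR', fun k => (hR'0 k).le, hR'1⟩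
  · have hset : {ω | (fun i => W i ω) ∈
        ⋂ k ∈ Finset.univ, (fun w : ℕ → ℝ => ∑ i ∈ block n x k, w i) ⁻¹' A k} =
        ⋂ k ∈ Finset.univ, (fun ω => ∑ i ∈ block n x k, W i ω) ⁻¹' A k := by
      ext ω; simp
    rw [hset, (iIndepFun_block_sums hW hind _
      (pairwise_disjoint_block n x)).measure_inter_preimage_eq_mul _ fun k _ => hAm k]
    refine le_trans ?_ (Finset.prod_le_prod' fun k _ =>
      hN₀ k (block n x k) ((le_max_right _ _).trans (h2 k)))
    rw [← ENNReal.ofReal_prod_of_nonneg fun k _ => by positivity]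
    apply ENNReal.ofReal_le_ofReal
    rw [Finset.prod_mul_distrib, Finset.prod_const, Finset.card_univ, ← Real.exp_sum,
      Finset.sum_neg_distrib]
    have hsum : ∑ k, ((block n x k).card : ℝ) * (powerFun γ (y k) + ε) =
        n * ∑ k, empirical n x k * (powerFun γ (y k) + ε) := by
      rw [Finset.mul_sum]
      refine Finset.sum_congr rfl fun k _ => ?_
      rw [empirical_eq]
      field_simp
    rw [hsum]
    have hnn : (0 : ℝ) ≤ n := Nat.cast_nonneg n
    calc Real.exp (-(n * b))
        = (1 / 2) ^ Fintype.card Y * (2 ^ Fintype.card Y * Real.exp (-(n * b))) := by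
          rw [← mul_assoc, ← mul_pow]; norm_num
      _ ≤ (1 / 2) ^ Fintype.card Y * (Real.exp (n * ε) * Real.exp (-(n * b))) := by gcongr
      _ ≤ _ := by
          rw [← Real.exp_add]
          gcongr
          have : n * (D + 2 * ε) + n * ε = n * b := by rw [hε]; ring
          nlinarith [mul_le_mul_of_nonneg_left h3.le hnn]

end

section

variable {ν : Measure ℝ} {Ω : Type*} [MeasurableSpace Ω] {μ : Measure Ω}
variable {Y : Type*}

/-! ### The law of large numbers for the bootstrapped measure -/

-- Enumerating the occurrences of `k` turns block sums into partial sums of one fixed subsequence,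
-- the form required by the strong law.
open Classical in
lemma sum_block_eq_sum_nth (x : ℕ → Y) (k : Y) (f : ℕ → ℝ) (n : ℕ) :
    ∑ i ∈ block n x k, f i =
      ∑ j ∈ Finset.range (block n x k).card, f (Nat.nth (fun i => x i = k) j) := by
  have hcard : ∀ n, (block n x k).card = Nat.count (fun i => x i = k) n := fun n =>
    (Nat.count_eq_card_filter_range _ n).symm
  rw [hcard]
  induction n with
  | zero => simp [block]
  | succ n ih =>
    have hb : block (n + 1) x k =
        if x n = k then insert n (block n x k) else block n x k := by
      rw [block, Finset.range_add_one, Finset.filter_insert]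
      rfl
    rw [hb, Nat.count_succ]
    split_ifs with h
    · rw [Finset.sum_insert (by simp [block]), Finset.sum_range_succ, ih,
        Nat.nth_count (p := fun i => x i = k) h, add_comm]
    · rw [ih, add_zero]

lemma ae_tendsto_block_mean {W : ℕ → Ω → ℝ} (hW : ∀ i, Measurable (W i))
    (hlaw : ∀ i, μ.map (W i) = ν) (hind : iIndepFun W μ) (hmean : ∫ w, w ∂ν = 1) {p : Y → ℝ}
    {x : ℕ → Y} {k : Y} (hpos : 0 < p k)
    (hx : Tendsto (fun n => empirical n x k) atTop (𝓝 (p k))) :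
    ∀ᵐ ω ∂μ, Tendsto (fun n => (∑ i ∈ block n x k, W i ω) / ((block n x k).card : ℝ)) atTop
      (𝓝 1) := by
  classical
  have hcard := tendsto_card_block hpos hx
  have hinf : (Set.ofPred fun i => x i = k).Infinite := by
    intro hfin
    obtain ⟨n, hn⟩ := (hcard.eventually_gt_atTop hfin.toFinset.card).exists
    refine absurd hn (not_lt.2 (Finset.card_le_card fun i hi => ?_))
    rw [Set.Finite.mem_toFinset]
    simp only [block, Finset.mem_filter] at hi
    exact hi.2
  set g := Nat.nth fun i => x i = k with hg
  have hginj : Function.Injective g := Nat.nth_injective hinf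
  have hEW : ∀ i, ∫ ω, W i ω ∂μ = 1 := fun i => by
    rw [← hmean, ← hlaw i]
    exact (integral_map (hW i).aemeasurable aestronglyMeasurable_id).symm
  -- A nonintegrable weight would have integral `0` by convention, not `1`.
  have hint : Integrable (W (g 0)) μ := by
    by_contra h
    have := hEW (g 0)
    rw [integral_undef h] at this
    exact zero_ne_one this
  have h := strong_law_ae_real (fun j => W (g j)) hint
    (fun i j hij => hind.indepFun (hginj.ne hij))
    fun i => ⟨(hW _).aemeasurable, (hW _).aemeasurable, by rw [hlaw, hlaw]⟩
  filter_upwards [h] with ω hω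
  rw [hEW] at hω
  refine (hω.comp hcard).congr fun n => ?_
  simp only [Function.comp_apply]
  rw [sum_block_eq_sum_nth]

/-- `S` is controlled only on the simplex, so nearness to `p` must be accompanied by membership in
the simplex. -/
lemma tendsto_functional [Fintype Y] {S : Option (Y → ℝ) → EReal}
    (hS : IsContinuousFunctional S) {p : Y → ℝ} (hp : p ∈ stdSimplex ℝ Y)
    {Q : ℕ → Option (Y → ℝ)}
    (hQ : ∀ U ∈ 𝓝 p, ∀ᶠ n in atTop, ∃ R ∈ U, Q n = some R ∧ R ∈ stdSimplex ℝ Y) :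
    Tendsto (fun n => S (Q n)) atTop (𝓝 (S (some p))) := by
  intro V hV
  obtain ⟨U, hU, hUV⟩ := mem_nhdsWithin_iff_exists_mem_nhds_inter.1 (hS p hp hV)
  change ∀ᶠ n in atTop, S (Q n) ∈ V
  filter_upwards [hQ U hU] with n ⟨R, hRU, hR, hRs⟩
  rw [hR]
  exact hUV ⟨hRU, hRs⟩

/-- The first `n` observations take finitely many values, and those of probability zero form a null
set. This keeps the elementary conditional probabilities nondegenerate. -/
lemma ae_measure_data_ne_zero [Finite Y] (X : ℕ → Ω → Y) :
    ∀ᵐ ω ∂μ, ∀ n, μ {ω' | ∀ i < n, X i ω' = X i ω} ≠ 0 := by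
  refine ae_all_iff.2 fun n => ?_
  rw [ae_iff]
  have hsub : {ω | ¬ μ {ω' | ∀ i < n, X i ω' = X i ω} ≠ 0} ⊆
      ⋃ v : {v : Fin n → Y // μ {ω' | ∀ i : Fin n, X i ω' = v i} = 0},
        {ω' | ∀ i : Fin n, X i ω' = v.1 i} := by
    intro ω hω
    have h : μ {ω' | ∀ i < n, X i ω' = X i ω} = 0 := not_not.1 hω
    refine Set.mem_iUnion.2 ⟨⟨fun i => X i ω, ?_⟩, fun i => rfl⟩
    refine measure_mono_null (fun ω' hω' i hi => hω' ⟨i, hi⟩) h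
  exact measure_mono_null hsub (measure_iUnion_null fun v => v.2)

lemma bootMeasure_congr {n : ℕ} {x x' : ℕ → Y} (h : ∀ i < n, x i = x' i) (w : ℕ → ℝ) :
    bootMeasure n x w = bootMeasure n x' w := by
  have hb : ∀ k, block n x k = block n x' k := fun k => by
    ext i
    simp only [block, Finset.mem_filter, Finset.mem_range]
    exact and_congr_right fun hi => by rw [h i hi]
  by_cases h0 : ∑ j ∈ Finset.range n, w j = 0
  · rw [bootMeasure_eq_none h0, bootMeasure_eq_none h0]
  · simp only [bootMeasure_eq_some h0, hb]

variable [MeasurableSpace Y] [MeasurableSingletonClass Y]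

lemma measurable_card_block (n : ℕ) (k : Y) :
    Measurable fun z : ℕ → Y => ((block n z k).card : ℝ) := by
  classical
  have h : (fun z : ℕ → Y => ((block n z k).card : ℝ)) =
      fun z => ∑ i ∈ Finset.range n, if z i = k then (1 : ℝ) else 0 := by
    funext z
    simp [block]
  rw [h]
  exact Finset.measurable_sum _ fun i _ => Measurable.ite
    (measurable_pi_apply (X := fun _ : ℕ => Y) i (measurableSet_singleton k)) measurable_const
    measurable_const

lemma measurable_sum_block (n : ℕ) (k : Y) :
    Measurable fun v : (ℕ → Y) × (ℕ → ℝ) => ∑ i ∈ block n v.1 k, v.2 i := by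
  classical
  have h : (fun v : (ℕ → Y) × (ℕ → ℝ) => ∑ i ∈ block n v.1 k, v.2 i) =
      fun v => ∑ i ∈ Finset.range n, if v.1 i = k then v.2 i else 0 := by
    funext v
    rw [block, Finset.sum_filter]
  rw [h]
  refine Finset.measurable_sum _ fun i _ => Measurable.ite ?_ (by fun_prop) measurable_const
  exact ((measurable_pi_apply (X := fun _ : ℕ => Y) i).comp
    (measurable_fst (β := ℕ → ℝ))) (measurableSet_singleton k)

/-- By independence the joint law of observations and weights is a product, so Fubini reduces the
claim to a fixed sequence of observations. -/
lemma ae_tendsto_block_mean_of_indepFun {W : ℕ → Ω → ℝ} (hW : ∀ i, Measurable (W i))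
    (hlaw : ∀ i, μ.map (W i) = ν) (hind : iIndepFun W μ) (hmean : ∫ w, w ∂ν = 1)
    {Z : ℕ → Ω → Y} (hZ : ∀ i, Measurable (Z i))
    (hdata : IndepFun (fun ω i => Z i ω) (fun ω i => W i ω) μ) {p : Y → ℝ} {k : Y}
    (hpos : 0 < p k)
    (hlim : ∀ᵐ ω ∂μ, Tendsto (fun n => empirical n (fun i => Z i ω) k) atTop (𝓝 (p k))) :
    ∀ᵐ ω ∂μ, Tendsto (fun n => (∑ i ∈ block n (fun i => Z i ω) k, W i ω) /
      ((block n (fun i => Z i ω) k).card : ℝ)) atTop (𝓝 1) := by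
  have : IsProbabilityMeasure μ := hind.isProbabilityMeasure
  have hZm : Measurable fun ω i => Z i ω := measurable_pi_iff.2 hZ
  have hWm : Measurable fun ω i => W i ω := measurable_pi_iff.2 hW
  have hset : MeasurableSet {v : (ℕ → Y) × (ℕ → ℝ) | Tendsto (fun n =>
      (∑ i ∈ block n v.1 k, v.2 i) / ((block n v.1 k).card : ℝ)) atTop (𝓝 1)} :=
    measurableSet_tendsto _ fun n =>
      (measurable_sum_block n k).div ((measurable_card_block n k).comp measurable_fst)
  have hemp : MeasurableSet {z : ℕ → Y | Tendsto (fun n => empirical n z k) atTop (𝓝 (p k))} :=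
    measurableSet_tendsto _ fun n => (measurable_card_block n k).div_const _
  have := Measure.isProbabilityMeasure_map (μ := μ) hWm.aemeasurable
  have key : ∀ᵐ v ∂((μ.map fun ω i => Z i ω).prod (μ.map fun ω i => W i ω)),
      Tendsto (fun n => (∑ i ∈ block n v.1 k, v.2 i) / ((block n v.1 k).card : ℝ)) atTop
        (𝓝 1) := by
    rw [Measure.ae_prod_iff_ae_ae hset]
    filter_upwards [(ae_map_iff hZm.aemeasurable hemp).2 hlim] with z hz
    refine (ae_map_iff hWm.aemeasurable (hset.preimage measurable_prodMk_left)).2 ?_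
    exact ae_tendsto_block_mean hW hlaw hind hmean hpos hz
  rw [← hdata.map_prod_eq_prod_map_map hZm.aemeasurable hWm.aemeasurable] at key
  exact (ae_map_iff (hZm.prodMk hWm).aemeasurable hset).1 key

/-- Almost surely the bootstrapped measure converges to the limit of the empirical measures. -/
lemma ae_bootMeasure_tendsto [Fintype Y] {W : ℕ → Ω → ℝ} (hW : ∀ i, Measurable (W i))
    (hlaw : ∀ i, μ.map (W i) = ν) (hind : iIndepFun W μ) (hmean : ∫ w, w ∂ν = 1)
    {Z : ℕ → Ω → Y} (hZ : ∀ i, Measurable (Z i))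
    (hdata : IndepFun (fun ω i => Z i ω) (fun ω i => W i ω) μ) {p : Y → ℝ}
    (hp : p ∈ stdSimplex ℝ Y) (hpos : ∀ k, 0 < p k)
    (hlim : ∀ᵐ ω ∂μ, ∀ k, Tendsto (fun n => empirical n (fun i => Z i ω) k) atTop (𝓝 (p k))) :
    ∀ᵐ ω ∂μ, ∀ U ∈ 𝓝 p, ∀ᶠ n in atTop, ∃ R ∈ U,
      bootMeasure n (fun i => Z i ω) (fun i => W i ω) = some R ∧ R ∈ stdSimplex ℝ Y := by
  have h := ae_all_iff.2 fun k => ae_tendsto_block_mean_of_indepFun hW hlaw hind hmean hZ hdata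
    (hpos k) (hlim.mono fun ω hω => hω k)
  filter_upwards [hlim, h] with ω h1 h2 U hU
  have hU' : U ∩ {R' | ∀ k, 0 < R' k} ∈ 𝓝 p := by
    refine inter_mem hU ?_
    have : ∀ᶠ R' in 𝓝 p, ∀ k, 0 < R' k := by
      rw [eventually_all]
      exact fun k => (continuous_apply k).continuousAt.eventually (lt_mem_nhds (hpos k))
    exact this
  obtain ⟨δ, hδ, hboot⟩ := exists_forall_bootMeasure_mem (y := fun _ => 1) one_pos
    (fun k => mul_comm _ _) hp hU' hpos h1
  have hev : ∀ᶠ n in atTop, ∀ k, |(∑ i ∈ block n (fun i => Z i ω) k, W i ω) /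
      ((block n (fun i => Z i ω) k).card : ℝ) - 1| < δ := by
    rw [eventually_all]
    exact fun k => (Metric.tendsto_nhds.1 (h2 k)) δ hδ
  filter_upwards [hboot, hev] with n h3 h4
  obtain ⟨R, ⟨hRU, hR0⟩, hR, hR1⟩ := h3 _ h4
  exact ⟨R, hRU, hR, fun k => (hR0 k).le, hR1⟩

/-! ### Conditioning on the observations -/

lemma cond_weights_eq [IsProbabilityMeasure μ] {X : ℕ → Ω → Y} (hX : ∀ i, Measurable (X i))
    {W : ℕ → Ω → ℝ} (hdata : IndepFun (fun ω i => X i ω) (fun ω i => W i ω) μ) {n : ℕ} {ω : Ω}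
    (h0 : μ {ω' | ∀ i < n, X i ω' = X i ω} ≠ 0) {B : Set (ℕ → ℝ)} (hB : MeasurableSet B) :
    MeasurableSet {ω' | ∀ i < n, X i ω' = X i ω} ∧
    (μ {ω' | ∀ i < n, X i ω' = X i ω})⁻¹ *
      μ ({ω' | ∀ i < n, X i ω' = X i ω} ∩ {ω' | (fun i => W i ω') ∈ B}) =
      μ {ω' | (fun i => W i ω') ∈ B} := by
  have hXm : Measurable fun ω i => X i ω := measurable_pi_iff.2 hX
  have hC : MeasurableSet {v : ℕ → Y | ∀ i < n, v i = X i ω} := by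
    have : {v : ℕ → Y | ∀ i < n, v i = X i ω} = ⋂ i ∈ Finset.range n, {v | v i = X i ω} := by
      ext v; simp
    rw [this]
    exact Finset.measurableSet_biInter _ fun i _ =>
      (measurable_pi_apply i) (measurableSet_singleton _)
  refine ⟨hXm hC, ?_⟩
  have h := hdata.measure_inter_preimage_eq_mul _ _ hC hB
  change μ ({ω' | ∀ i < n, X i ω' = X i ω} ∩ {ω' | (fun i => W i ω') ∈ B}) =
    μ {ω' | ∀ i < n, X i ω' = X i ω} * μ {ω' | (fun i => W i ω') ∈ B} at h
  rw [h, ← mul_assoc, ENNReal.inv_mul_cancel h0 (measure_ne_top _ _), one_mul]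

/-- `S` is not assumed measurable, so the tail event is compared by monotonicity with a measurable
event on the weights, whose probability conditioning leaves unchanged. -/
lemma tailProb_le [IsProbabilityMeasure μ] {X : ℕ → Ω → Y} (hX : ∀ i, Measurable (X i))
    {W : ℕ → Ω → ℝ} (hdata : IndepFun (fun ω i => X i ω) (fun ω i => W i ω) μ) {n : ℕ} {ω : Ω}
    (h0 : μ {ω' | ∀ i < n, X i ω' = X i ω} ≠ 0) {B : Set (ℕ → ℝ)} (hB : MeasurableSet B)
    {S : Option (Y → ℝ) → EReal} {t : EReal}
    (h : ∀ w, t < S (bootMeasure n (fun i => X i ω) w) → w ∈ B) :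
    tailProb μ X W S n t ω ≤ μ {ω' | (fun i => W i ω') ∈ B} := by
  obtain ⟨hA, heq⟩ := cond_weights_eq hX hdata h0 hB
  rw [tailProb, cond_apply hA, ← heq]
  refine mul_le_mul_right (measure_mono ?_) _
  rintro ω' ⟨h1, h2⟩
  refine ⟨h1, h _ ?_⟩
  rwa [← bootMeasure_congr h1]

lemma le_tailProb [IsProbabilityMeasure μ] {X : ℕ → Ω → Y} (hX : ∀ i, Measurable (X i))
    {W : ℕ → Ω → ℝ} (hdata : IndepFun (fun ω i => X i ω) (fun ω i => W i ω) μ) {n : ℕ} {ω : Ω}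
    (h0 : μ {ω' | ∀ i < n, X i ω' = X i ω} ≠ 0) {B : Set (ℕ → ℝ)} (hB : MeasurableSet B)
    {S : Option (Y → ℝ) → EReal} {t : EReal}
    (h : ∀ w ∈ B, t < S (bootMeasure n (fun i => X i ω) w)) :
    μ {ω' | (fun i => W i ω') ∈ B} ≤ tailProb μ X W S n t ω := by
  obtain ⟨hA, heq⟩ := cond_weights_eq hX hdata h0 hB
  rw [tailProb, cond_apply hA, ← heq]
  refine mul_le_mul_right (measure_mono ?_) _
  rintro ω' ⟨h1, h2⟩
  refine ⟨h1, ?_⟩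
  change t < S (bootMeasure n (fun i => X i ω') fun i => W i ω')
  rw [bootMeasure_congr h1]
  exact h _ h2

lemma log_div_le {n : ℕ} (hn : n ≠ 0) {b : ℝ} {u : ENNReal}
    (h : u ≤ ENNReal.ofReal (Real.exp (-(n * b)))) :
    ENNReal.log u / (n : EReal) ≤ ((-b : ℝ) : EReal) := by
  have hn0 : (0 : EReal) < n := by exact_mod_cast Nat.pos_of_ne_zero hn
  rw [EReal.div_le_iff_le_mul hn0 (EReal.natCast_ne_top n)]
  refine (ENNReal.log_le_log h).trans ?_
  rw [ENNReal.log_ofReal_of_pos (Real.exp_pos _), Real.log_exp]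
  have : (n : EReal) = ((n : ℝ) : EReal) := rfl
  rw [this, ← EReal.coe_mul]
  simp

lemma le_log_div {n : ℕ} (hn : n ≠ 0) {b : ℝ} {u : ENNReal}
    (h : ENNReal.ofReal (Real.exp (-(n * b))) ≤ u) :
    ((-b : ℝ) : EReal) ≤ ENNReal.log u / (n : EReal) := by
  have hn0 : (0 : EReal) < n := by exact_mod_cast Nat.pos_of_ne_zero hn
  rw [EReal.le_div_iff_mul_le hn0 (EReal.natCast_ne_top n)]
  refine le_trans ?_ (ENNReal.log_le_log h)
  rw [ENNReal.log_ofReal_of_pos (Real.exp_pos _), Real.log_exp]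
  have : (n : EReal) = ((n : ℝ) : EReal) := rfl
  rw [this, ← EReal.coe_mul]
  simp [mul_comm]

end

section

variable {ν : Measure ℝ} {Ω : Type*} [MeasurableSpace Ω] {μ : Measure Ω}
variable {Y : Type*} [Fintype Y]

/-! ### Exponential rates of the tests -/

lemma neg_le_of_forall_real {c L : EReal} (h : ∀ b : ℝ, c < b → ((-b : ℝ) : EReal) ≤ L) :
    -c ≤ L := by
  by_contra! hlt
  obtain ⟨r, h1, h2⟩ := EReal.lt_iff_exists_real_btwn.1 hlt
  have h3 := h (-r) (by rw [EReal.coe_neg]; exact EReal.lt_neg_comm.1 h2)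
  rw [neg_neg] at h3
  exact absurd h1 (not_lt.2 h3)

lemma tendsto_neg_of_bounds {f : ℕ → EReal} {c : EReal} (hlow : -c ≤ liminf f atTop)
    (hup : ∀ b : ℝ, (b : EReal) < c → ∀ᶠ n in atTop, f n ≤ ((-b : ℝ) : EReal)) :
    Tendsto f atTop (𝓝 (-c)) := by
  refine tendsto_of_le_liminf_of_limsup_le hlow ?_
  by_contra! hlt
  obtain ⟨r, h1, h2⟩ := EReal.lt_iff_exists_real_btwn.1 hlt
  have h3 := hup (-r) (by rw [EReal.coe_neg]; exact EReal.neg_lt_comm.1 h1)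
  rw [neg_neg] at h3
  exact absurd h2 (not_lt.2 (limsup_le_of_le (by isBoundedDefault) h3))

/-- If the infimum over the weak exceedance set exceeds `a`, some level below `S(P')` already
forces the divergence statistic above `a`. -/
lemma exists_level [IsProbabilityMeasure ν] {γ : ℝ} (hγ : IsPowerWeight ν γ) {p p' : Y → ℝ}
    (hp : p ∈ stdSimplex ℝ Y) (hpos : ∀ k, 0 < p k) {S : Option (Y → ℝ) → EReal}
    (hS : IsContinuousFunctional S) {a : ℝ} (ha0 : 0 < a)
    (ha : (a : EReal) < ⨅ Q ∈ weakExceedSet S p', scaledDiv ν Q p) :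
    ∃ s < S (some p'), ∀ Q ∈ stdSimplex ℝ Y, s < S (some Q) → (a : EReal) < scaledDiv ν Q p := by
  -- The maximum of `S` over this compact sublevel set is the required level. Its maximizer lies
  -- outside the weak exceedance set, so the level is strictly below `S(P')`.
  set K : Set (Y → ℝ) := stdSimplex ℝ Y ∩ (fun Q => scaledDiv ν Q p) ⁻¹' Set.Iic (a : EReal) with hK
  have hKc : IsCompact K := (isCompact_stdSimplex ℝ Y).of_isClosed_subset
    ((continuousOn_scaledDiv hγ hp hpos).preimage_isClosed_of_isClosed
      (isClosed_stdSimplex ℝ Y) isClosed_Iic) Set.inter_subset_left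
  have hKne : K.Nonempty := by
    refine ⟨p, hp, ?_⟩
    have h := scaledDiv_le (ν := ν) hp.1 p one_ne_zero
    rw [one_smul, rateDiv_self hγ hpos] at h
    refine h.trans ?_
    rw [EReal.coe_ennreal_zero]
    exact_mod_cast ha0.le
  obtain ⟨Q₀, hQ₀, hmax⟩ := hKc.exists_isMaxOn hKne (hS.mono Set.inter_subset_left)
  have hlt : S (some Q₀) < S (some p') := by
    by_contra! h
    exact absurd (ha.trans_le (iInf₂_le Q₀ ⟨hQ₀.1, h⟩)) (not_lt.2 hQ₀.2)
  refine ⟨S (some Q₀), hlt, fun Q hQ hs => ?_⟩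
  by_contra! h
  exact absurd hs (not_lt.2 (hmax ⟨hQ, h⟩))

variable [MeasurableSpace Y] [MeasurableSingletonClass Y]

/-- Lower bound for the exponential decay of the tail probability of a continuous functional. -/
lemma neg_iInf_le_liminf_logTail [IsProbabilityMeasure ν] {γ : ℝ} (hγ : IsPowerWeight ν γ)
    {X Z : ℕ → Ω → Y} (hX : ∀ i, Measurable (X i)) {W W' : ℕ → Ω → ℝ}
    (hW : ∀ i, Measurable (W i)) (hlaw : ∀ i, μ.map (W i) = ν) (hind : iIndepFun W μ)
    (hdata : IndepFun (fun ω i => X i ω) (fun ω i => W i ω) μ) {p p' : Y → ℝ}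
    (hp : p ∈ stdSimplex ℝ Y) (hpos : ∀ k, 0 < p k) {S : Option (Y → ℝ) → EReal}
    (hS : IsContinuousFunctional S) {ω : Ω}
    (hx : ∀ k, Tendsto (fun n => empirical n (fun i => X i ω) k) atTop (𝓝 (p k)))
    (h0 : ∀ n, μ {ω' | ∀ i < n, X i ω' = X i ω} ≠ 0)
    (hSlim : Tendsto (fun n => S (bootMeasure n (fun i => Z i ω) fun i => W' i ω)) atTop
      (𝓝 (S (some p')))) :
    -(⨅ Q ∈ exceedSet S p', scaledDiv ν Q p) ≤
      liminf (fun n => logTail μ X Z W W' S n ω) atTop := by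
  have : IsProbabilityMeasure μ := hind.isProbabilityMeasure
  refine neg_le_of_forall_real fun b hb => ?_
  simp only [iInf_lt_iff] at hb
  obtain ⟨Q, ⟨hQs, hQ⟩, hb⟩ := hb
  obtain ⟨m, hm, hmb⟩ := exists_pos_multiple hγ hp hpos hQs hb
  obtain ⟨s, hs1, hs2⟩ := exists_between hQ
  obtain ⟨U, hU, hUS⟩ := mem_nhdsWithin_iff_exists_mem_nhds_inter.1 (hS Q hQs (lt_mem_nhds hs2))
  obtain ⟨V, hVU, hVo, hQV⟩ := mem_nhds_iff.1 hU
  obtain ⟨R, hRV, hRs, hRpos, m', hm', hle⟩ := exists_pos_near hγ hp hpos hQs hm (hVo.mem_nhds hQV)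
  refine le_liminf_of_le (by isBoundedDefault) ?_
  filter_upwards [eventually_le_measure_bootMeasure_mem hγ hW hlaw hind hpos hx hRs hRpos hm'
    (hVo.mem_nhds hRV) ((EReal.coe_ennreal_le_coe_ennreal_iff.2 hle).trans_lt hmb),
    hSlim.eventually (gt_mem_nhds hs1), eventually_ne_atTop 0] with n ⟨B, hB, hBV, hBμ⟩ hs hn
  refine le_log_div hn (hBμ.trans (le_tailProb hX hdata (h0 n) hB fun w hw => ?_))
  obtain ⟨R', hR'V, hR', hR's⟩ := hBV w hw
  rw [hR']
  exact hs.trans (hUS ⟨hVU hR'V, hR's⟩)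

/-- Upper bound for the exponential decay of the tail probability of a functional that exceeds its
value at the alternative only where the divergence statistic is large. -/
lemma eventually_logTail_le [IsProbabilityMeasure ν] {γ : ℝ} (hγ : IsPowerWeight ν γ)
    {X Z : ℕ → Ω → Y} (hX : ∀ i, Measurable (X i)) {W W' : ℕ → Ω → ℝ}
    (hW : ∀ i, Measurable (W i)) (hlaw : ∀ i, μ.map (W i) = ν) (hind : iIndepFun W μ)
    (hdata : IndepFun (fun ω i => X i ω) (fun ω i => W i ω) μ) {p : Y → ℝ}
    (hp : p ∈ stdSimplex ℝ Y) (hpos : ∀ k, 0 < p k) {S : Option (Y → ℝ) → EReal} {ω : Ω}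
    (hx : ∀ k, Tendsto (fun n => empirical n (fun i => X i ω) k) atTop (𝓝 (p k)))
    (h0 : ∀ n, μ {ω' | ∀ i < n, X i ω' = X i ω} ≠ 0) {c : EReal} (hc : c ≤ rate ν 0)
    (hS : ∀ a : ℝ, 0 < a → (a : EReal) < c → ∀ᶠ n in atTop, ∀ w,
      S (bootMeasure n (fun i => Z i ω) fun i => W' i ω) <
        S (bootMeasure n (fun i => X i ω) w) →
      (a : EReal) < divStat ν p (bootMeasure n (fun i => X i ω) w))
    (b : ℝ) (hb : (b : EReal) < c) :
    ∀ᶠ n in atTop, logTail μ X Z W W' S n ω ≤ ((-b : ℝ) : EReal) := by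
  have : IsProbabilityMeasure μ := hind.isProbabilityMeasure
  -- For `b < 0` the bound only says that a probability is at most `1`.
  rcases lt_or_ge b 0 with hb0 | hb0
  · filter_upwards [eventually_ne_atTop 0] with n hn
    refine log_div_le hn (le_trans (b := 1) ?_ ?_)
    · refine (tailProb_le hX hdata (h0 n) MeasurableSet.univ fun _ _ => Set.mem_univ _).trans ?_
      exact prob_le_one
    · rw [ENNReal.one_le_ofReal, Real.one_le_exp_iff]
      have : (0 : ℝ) ≤ n := Nat.cast_nonneg n
      nlinarith
  obtain ⟨a, hba, hac⟩ := EReal.lt_iff_exists_real_btwn.1 hb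
  have hba : b < a := by exact_mod_cast hba
  have ha : ENNReal.ofReal a ≤ rate ν 0 := by
    rw [← EReal.coe_ennreal_le_coe_ennreal_iff, EReal.coe_ennreal_ofReal,
      max_eq_left (hb0.trans hba.le)]
    exact hac.le.trans hc
  filter_upwards [eventually_measure_lt_divStat_le hγ hW hlaw hind hp hpos hx hb0 hba ha,
    hS a (hb0.trans_lt hba) hac, eventually_ne_atTop 0] with n ⟨B, hB, hBT, hBμ⟩ h hn
  exact log_div_le hn ((tailProb_le hX hdata (h0 n) hB fun w hw => hBT w (h w hw)).trans hBμ)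

end

end GenBootstrap

end

/-! ### Assembly of the slope and optimality statements -/

theorem mainTheorem3
    {Y : Type*} [Fintype Y] [MeasurableSpace Y] [MeasurableSingletonClass Y]
    -- the model: probability measures with positive entries, identifiable
    {Θ : Type*} (P : Θ → Y → ℝ) (hP : ∀ τ, P τ ∈ stdSimplex ℝ Y) (hpos : ∀ τ k, 0 < P τ k)
    (hident : Function.Injective P)
    -- null value and alternative
    (θ θ' : Θ) (hne : θ ≠ θ')
    -- the law of the weights
    (ν : Measure ℝ) [IsProbabilityMeasure ν] (hν : GenBootstrap.IsWeightLaw ν)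
    (γ : ℝ) (hγ : GenBootstrap.IsPowerWeight ν γ)
    -- observations under the null and under the alternative, and the weights
    {Ω : Type*} [MeasurableSpace Ω] (μ : Measure Ω) [IsProbabilityMeasure μ]
    (X Z : ℕ → Ω → Y) (W W' : ℕ → Ω → ℝ)
    (hX : ∀ i, Measurable (X i)) (hZ : ∀ i, Measurable (Z i))
    (hW : ∀ i, Measurable (W i)) (hW' : ∀ i, Measurable (W' i))
    (hXlim : ∀ᵐ ω ∂μ, ∀ k,
      Tendsto (fun n => GenBootstrap.empirical n (fun i => X i ω) k) atTop (𝓝 (P θ k)))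
    (hZlim : ∀ᵐ ω ∂μ, ∀ k,
      Tendsto (fun n => GenBootstrap.empirical n (fun i => Z i ω) k) atTop (𝓝 (P θ' k)))
    (hWlaw : ∀ i, μ.map (W i) = ν) (hWlaw' : ∀ i, μ.map (W' i) = ν)
    (hWindep : iIndepFun (Sum.elim W W') μ)
    (hdata : IndepFun (fun ω => (fun i => W i ω, fun i => W' i ω))
      (fun ω => (fun i => X i ω, fun i => Z i ω)) μ) :
    -- the divergence statistic is an admissible functional, with slope `Φ(θ', θ)`
    GenBootstrap.IsContinuousFunctional (GenBootstrap.divStat ν (P θ)) ∧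
    P θ' ∈ closure (GenBootstrap.exceedSet (GenBootstrap.divStat ν (P θ)) (P θ')) ∧
    GenBootstrap.HasBahadurSlope μ X Z W W' (GenBootstrap.divStat ν (P θ))
      (GenBootstrap.scaledDiv ν (P θ') (P θ)) ∧
    -- every competing continuous functional
    ∀ S : Option (Y → ℝ) → EReal, GenBootstrap.IsContinuousFunctional S →
      (∀ᵐ ω ∂μ,
        -(⨅ Q ∈ GenBootstrap.exceedSet S (P θ'), GenBootstrap.scaledDiv ν Q (P θ)) ≤
          liminf (fun n => GenBootstrap.logTail μ X Z W W' S n ω) atTop) ∧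
      ((∀ R : Option (Y → ℝ), R ∉ some '' stdSimplex ℝ Y → S R = ⊥) →
        (⨅ Q ∈ GenBootstrap.exceedSet S (P θ'), GenBootstrap.scaledDiv ν Q (P θ)) =
          (⨅ Q ∈ GenBootstrap.weakExceedSet S (P θ'), GenBootstrap.scaledDiv ν Q (P θ)) →
        GenBootstrap.HasBahadurSlope μ X Z W W' S
          (⨅ Q ∈ GenBootstrap.exceedSet S (P θ'), GenBootstrap.scaledDiv ν Q (P θ))) ∧
      (P θ' ∈ closure (GenBootstrap.exceedSet S (P θ')) →
        (⨅ Q ∈ GenBootstrap.exceedSet S (P θ'), GenBootstrap.scaledDiv ν Q (P θ)) ≤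
          GenBootstrap.scaledDiv ν (P θ') (P θ) ∧
        (∀ᵐ ω ∂μ, -GenBootstrap.scaledDiv ν (P θ') (P θ) ≤
          liminf (fun n => GenBootstrap.logTail μ X Z W W' S n ω) atTop) ∧
        ∀ c : EReal, GenBootstrap.HasBahadurSlope μ X Z W W' S c →
          c ≤ GenBootstrap.scaledDiv ν (P θ') (P θ)) := by
  have hWm : iIndepFun W μ := hWindep.precomp (g := Sum.inl) Sum.inl_injective
  have hWm' : iIndepFun W' μ := hWindep.precomp (g := Sum.inr) Sum.inr_injective
  have hXW : IndepFun (fun ω i => X i ω) (fun ω i => W i ω) μ :=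
    (hdata.comp measurable_fst measurable_fst).symm
  have hZW : IndepFun (fun ω i => Z i ω) (fun ω i => W' i ω) μ :=
    (hdata.comp measurable_snd measurable_snd).symm
  have hboot := GenBootstrap.ae_bootMeasure_tendsto hW' hWlaw' hWm' hν.mean hZ hZW (hP θ')
    (hpos θ') hZlim
  have hfib := GenBootstrap.ae_measure_data_ne_zero (μ := μ) X
  have hTcont : GenBootstrap.IsContinuousFunctional (GenBootstrap.divStat ν (P θ)) :=
    GenBootstrap.continuousOn_scaledDiv hγ (hP θ) (hpos θ)
  have hTcl := GenBootstrap.mem_closure_exceedSet_divStat hγ (hP θ) (hpos θ) (hP θ') (hpos θ')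
    fun h => hne (hident h).symm
  have hlow : ∀ S, GenBootstrap.IsContinuousFunctional S → ∀ᵐ ω ∂μ,
      -(⨅ Q ∈ GenBootstrap.exceedSet S (P θ'), GenBootstrap.scaledDiv ν Q (P θ)) ≤
        liminf (fun n => GenBootstrap.logTail μ X Z W W' S n ω) atTop := fun S hS => by
    filter_upwards [hXlim, hboot, hfib] with ω h1 h2 h3
    exact GenBootstrap.neg_iInf_le_liminf_logTail hγ hX hW hWlaw hWm hXW (hP θ) (hpos θ) hS h1 h3
      (GenBootstrap.tendsto_functional hS (hP θ') h2)
  have hinf : ∀ S, P θ' ∈ closure (GenBootstrap.exceedSet S (P θ')) →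
      (⨅ Q ∈ GenBootstrap.exceedSet S (P θ'), GenBootstrap.scaledDiv ν Q (P θ)) ≤
        GenBootstrap.scaledDiv ν (P θ') (P θ) := fun S hcl => by
    have hcw := (GenBootstrap.continuousOn_scaledDiv hγ (hP θ) (hpos θ) (P θ') (hP θ')).mono
      (fun Q hQ => hQ.1 : GenBootstrap.exceedSet S (P θ') ⊆ stdSimplex ℝ Y)
    have := mem_closure_iff_nhdsWithin_neBot.1 hcl
    refine ge_of_tendsto hcw ?_
    filter_upwards [self_mem_nhdsWithin] with Q hQ using iInf₂_le Q hQ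
  have hle0 := GenBootstrap.scaledDiv_le_rate_zero hγ (hP θ) (hpos θ) (hP θ')
  refine ⟨hTcont, hTcl, ?_, fun S hS => ⟨hlow S hS, fun hbot heq => ?_, fun hcl => ?_⟩⟩
  · filter_upwards [hXlim, hboot, hfib, hlow _ hTcont] with ω h1 h2 h3 h4
    refine GenBootstrap.tendsto_neg_of_bounds
      ((EReal.neg_le_neg_iff.2 (hinf _ hTcl)).trans h4) ?_
    refine GenBootstrap.eventually_logTail_le hγ hX hW hWlaw hWm hXW (hP θ) (hpos θ) h1 h3 hle0 ?_
    -- The threshold tends to `Φ(θ', θ) > a`, so exceeding it forces `T > a`. The value `T(∞) = +∞`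
    -- is harmless because levels up to `φ^W(0)` are covered by the upper bound.
    intro a _ ha
    filter_upwards [(GenBootstrap.tendsto_functional hTcont (hP θ') h2).eventually
      (lt_mem_nhds ha)] with n hn w hw using hn.trans hw
  · filter_upwards [hXlim, hboot, hfib, hlow S hS] with ω h1 h2 h3 h4
    refine GenBootstrap.tendsto_neg_of_bounds h4 ?_
    refine GenBootstrap.eventually_logTail_le hγ hX hW hWlaw hWm hXW (hP θ) (hpos θ) h1 h3 ?_ ?_
    -- `P θ'` belongs to its own weak exceedance set, so `I_S ≤ Φ(θ', θ) ≤ φ^W(0)`.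
    · rw [heq]
      exact (iInf₂_le (P θ') ⟨hP θ', le_rfl⟩).trans hle0
    intro a ha0 ha
    rw [heq] at ha
    obtain ⟨s, hs, hQ⟩ := GenBootstrap.exists_level hγ (hP θ) (hpos θ) hS ha0 ha
    filter_upwards [(GenBootstrap.tendsto_functional hS (hP θ') h2).eventually
      (lt_mem_nhds hs)] with n hn w hw
    -- With value `-∞` off the simplex, strict exceedance of any threshold places the bootstrapped
    -- measure in the simplex, where the level from `exists_level` applies.
    have hmem : GenBootstrap.bootMeasure n (fun i => X i ω) w ∈ some '' stdSimplex ℝ Y := by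
      by_contra h
      rw [hbot _ h] at hw
      exact not_lt_bot hw
    obtain ⟨Q, hQs, hQeq⟩ := hmem
    rw [← hQeq] at hw ⊢
    exact hQ Q hQs (hn.trans hw)
  · have hlow' : ∀ᵐ ω ∂μ, -GenBootstrap.scaledDiv ν (P θ') (P θ) ≤
        liminf (fun n => GenBootstrap.logTail μ X Z W W' S n ω) atTop := by
      filter_upwards [hlow S hS] with ω h
      exact (EReal.neg_le_neg_iff.2 (hinf S hcl)).trans h
    refine ⟨hinf S hcl, hlow', fun c hc => ?_⟩
    obtain ⟨ω, h1, h2⟩ := (hlow'.and hc).exists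
    rw [h2.liminf_eq] at h1
    exact EReal.neg_le_neg_iff.1 h1
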